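/- All graphs are finite and simple. For a graph $G$ with degrees $d_G(\cdot)$, the sum-connectivity index is $$\chi(G)=\sum_{uv\in E(G)}\frac{1}{\sqrt{d_G(u)+d_G(v)}}.$$ A connected graph with $n$ vertices is bicyclic if it has exactly $n+1$ edges; let $\mathbb{B}(n)$ be the set of bicyclic graphs on $n$ vertices. Let $D$ be the unique bicyclic graph on four vertices, that is, $K_4$ minus an edge. For $a\ge b\ge 3$ with $a+b=n+2$, let $B_n(a,b)$ be the graph obtained from $D$ by attaching $a-3$ pendent vertices to one of its two vertices of degree three and $b-3$ pendent vertices to the other. For $n\ge 6$, let $B_{n,3}$ be the graph obtained from two triangles sharing exactly one vertex by attaching $n-5$ pendent vertices to the shared vertex. **Theorem.** Let $n\ge 5$. Up to isomorphism: 1. $B_n(n-1,3)$ is the unique graph with the minimum sum-connectivity index among the graphs in $\mathbb{B}(n)$, and this minimum is $$\frac{1}{\sqrt{n+2}}+\frac{n-4}{\sqrt{n}}+\frac{2}{\sqrt{n+1}}+\frac{2}{\sqrt5}.$$ 2. The second minimum, i.e. the smallest value of $\chi$ on $\mathbb{B}(n)$ that is larger than the minimum, is attained by exactly one graph in $\mathbb{B}(n)$,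 as follows. - If $n=5$, it is attained only by the graph obtained from $D$ by attaching a pendent vertex to a vertex of degree two, and is equal to $$\frac{3}{\sqrt6}+\frac{2}{\sqrt5}+\frac12.$$ - If $n=6$ or $n=7$, it is attained only by $B_n(n-2,4)$, and is equal to $$\frac{1}{\sqrt{n+2}}+\frac{2}{\sqrt{n}}+\frac{n-5}{\sqrt{n-1}}+\frac{2}{\sqrt6}+\frac{1}{\sqrt5}.$$ - If $n\ge 8$, it is attained only by $B_{n,3}$, and is equal to $$\frac{4}{\sqrt{n+1}}+\frac{n-5}{\sqrt{n}}+1.$$ -/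

import Mathlib

noncomputable section

namespace SumConn

open Classical in
/-- The sum-connectivity index: the sum over the edges `uv` of `1 / √(d(u) + d(v))`. -/
def sumConnectivity {V : Type*} [Fintype V] (G : SimpleGraph V) : ℝ :=
  ∑ e ∈ G.edgeFinset,
    Sym2.lift ⟨fun u v : V => 1 / √((G.degree u : ℝ) + (G.degree v : ℝ)),
      fun u v => by simp only [add_comm]⟩ e

open Classical in
/-- The bicyclic graphs with vertex set `V`: connected, with exactly `|V| + 1` edges. -/
def bicyclicGraphs (V : Type*) [Fintype V] : Set (SimpleGraph V) :=
  {G | G.Connected ∧ G.edgeFinset.card = Fintype.card V + 1}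

/-- The graph obtained from `H` by attaching, for every `p : P`, a new pendent vertex to the
vertex `f p` of `H`. -/
def attachPendents {W P : Type*} (H : SimpleGraph W) (f : P → W) : SimpleGraph (W ⊕ P) where
  Adj x y :=
    match x, y with
    | Sum.inl u, Sum.inl v => H.Adj u v
    | Sum.inl u, Sum.inr p => f p = u
    | Sum.inr p, Sum.inl u => f p = u
    | Sum.inr _, Sum.inr _ => False
  symm := ⟨by
    rintro (u | p) (v | q) h
    · exact H.adj_symm h
    · exact h
    · exact h
    · exact h⟩
  loopless := ⟨by
    rintro (u | p) h
    · exact H.loopless.irrefl u h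
    · exact h⟩

/-- The 4-vertex bicyclic graph, `K₄` minus the edge `{2, 3}`; the vertices of degree three are
`0` and `1`, those of degree two are `2` and `3`. -/
def diamond : SimpleGraph (Fin 4) :=
  SimpleGraph.fromEdgeSet {s(0, 1), s(0, 2), s(0, 3), s(1, 2), s(1, 3)}

/-- Two triangles sharing the vertex `0`. -/
def bowtie : SimpleGraph (Fin 5) :=
  SimpleGraph.fromEdgeSet {s(0, 1), s(0, 2), s(1, 2), s(0, 3), s(0, 4), s(3, 4)}

/-- `B_n(a, b)`, where `n = a + b - 2` and `a, b ≥ 3`: attach `a - 3` pendent vertices to one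
vertex of degree three of the diamond and `b - 3` to the other. -/
def graphB (a b : ℕ) : SimpleGraph (Fin 4 ⊕ (Fin (a - 3) ⊕ Fin (b - 3))) :=
  attachPendents diamond (Sum.elim (fun _ => 0) (fun _ => 1))

/-- `B_{n,3}`, where `n ≥ 5`: attach `n - 5` pendent vertices to the common vertex of the two
triangles of the bowtie. -/
def graphBThree (n : ℕ) : SimpleGraph (Fin 5 ⊕ Fin (n - 5)) :=
  attachPendents bowtie (fun _ => 0)

/-- The 5-vertex graph obtained by attaching a pendent vertex to a vertex of degree two of the
diamond. -/
def graphFive : SimpleGraph (Fin 4 ⊕ Fin 1) :=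
  attachPendents diamond (fun _ => 2)

/-- `c` is the minimum sum-connectivity index among the bicyclic graphs on `V`, and the graphs
attaining it are exactly those isomorphic to `B`. -/
def IsUniqueMinimum (V : Type*) [Fintype V] {W : Type*} (B : SimpleGraph W) (c : ℝ) : Prop :=
  IsLeast (sumConnectivity '' bicyclicGraphs V) c ∧
    ∀ G ∈ bicyclicGraphs V, sumConnectivity G = c ↔ Nonempty (G ≃g B)

/-- `c` is the second minimum sum-connectivity index among the bicyclic graphs on `V`, that is,
the least of the values that are not the minimum one, and the graphs attaining it are exactly
those isomorphic to `B`. -/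
def IsUniqueSecondMinimum (V : Type*) [Fintype V] {W : Type*} (B : SimpleGraph W) (c : ℝ) :
    Prop :=
  IsLeast {x ∈ sumConnectivity '' bicyclicGraphs V |
      ∃ y ∈ sumConnectivity '' bicyclicGraphs V, y < x} c ∧
    ∀ G ∈ bicyclicGraphs V, sumConnectivity G = c ↔ Nonempty (G ≃g B)

end SumConn

end

noncomputable section

namespace SumConn

open scoped Classical
open SimpleGraph

/-! Suppose first that some vertex is adjacent to all others. It uses n - 1 of the n + 1 edges, and
the two remaining edges either share an endpoint or are disjoint. So the graph is `B_n(n-1,3)` or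
`B_{n,3}` (`iso_of_degree_add_one_eq_card`), and the former has the smaller index.

It remains to treat graphs with all degrees at most n - 2: each is the claimed second minimizer (n =
5, 6, 7) or has index strictly above `secondValue n`. This is `isSecondMinimizer_or_secondValue_lt`,
proved by induction on n.

Without pendent vertices the index is too large, by convexity of 1/√x
(`le_sumConnectivity_of_two_le_degree`). Otherwise delete a pendent vertex whose neighbour has
degree d. The index drops by at least `pendentGain d`, which is antitone in d (`add_pendentGain_le`,
`pendentGain_anti`).

If the smaller graph has a vertex adjacent to all others, its index is at least that of
`B_{n-1}(n-2,3)`. Then d ≤ 3 gives a large enough gain, while d ≥ 4 forces the original graph to be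
`B_n(n-2,4)`. If it has none, the induction hypothesis together with
`secondValue_lt_add_pendentGain` suffices. The one exception is n = 7 with d = 5, where the gain is
too small; `secondValue_seven_lt` settles it by a direct edge count. -/

/-- The weight `1 / √k` of an edge whose end vertices have degree sum `k`. -/
def invSqrt (k : ℕ) : ℝ := 1 / √(k : ℝ)

/-- The weight of an unordered pair, for the vertex degrees `D`. -/
def weight {V : Type*} (D : V → ℕ) : Sym2 V → ℝ :=
  Sym2.lift ⟨fun u v => invSqrt (D u + D v), fun u v => by simp only [add_comm]⟩

@[simp]
theorem weight_mk {V : Type*} (D : V → ℕ) (u v : V) :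
    weight D s(u, v) = invSqrt (D u + D v) := rfl

/-! ### Isomorphism invariance -/

theorem sumConnectivity_eq {V : Type*} [Fintype V] (G : SimpleGraph V) :
    sumConnectivity G = ∑ e ∈ G.edgeFinset, weight (fun v => G.degree v) e := by
  unfold sumConnectivity
  refine Finset.sum_congr rfl fun e _ => ?_
  induction e with
  | h u v => simp [invSqrt]

theorem sumConnectivity_congr {V W : Type*} [Fintype V] [Fintype W] {G : SimpleGraph V}
    {H : SimpleGraph W} (e : G ≃g H) : sumConnectivity G = sumConnectivity H := by
  rw [sumConnectivity_eq, sumConnectivity_eq]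
  refine Finset.sum_nbij' (Sym2.map e) (Sym2.map e.symm) ?_ ?_ ?_ ?_ ?_
  · intro a
    induction a with
    | h u v => simpa using e.map_adj_iff.2
  · intro a
    induction a with
    | h u v => simpa using e.symm.map_adj_iff.2
  · intro a _
    simp [Sym2.map_map]
  · intro a _
    simp [Sym2.map_map]
  · intro a _
    induction a with
    | h u v => simp

theorem mem_bicyclicGraphs_congr {V W : Type*} [Fintype V] [Fintype W] {G : SimpleGraph V}
    {H : SimpleGraph W} (e : G ≃g H) (hG : G ∈ bicyclicGraphs V) : H ∈ bicyclicGraphs W := by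
  refine ⟨e.connected_iff.1 hG.1, ?_⟩
  rw [← Fintype.card_congr e.toEquiv, ← hG.2]
  exact (e.card_edgeFinset_eq).symm

/-! ### Degrees and edge sums after attaching pendent vertices -/

section attachPendents

variable {W P : Type*} (H : SimpleGraph W) (f : P → W)

@[simp]
theorem attachPendents_adj_inl_inl (a b : W) :
    (attachPendents H f).Adj (Sum.inl a) (Sum.inl b) ↔ H.Adj a b := Iff.rfl

@[simp]
theorem attachPendents_adj_inl_inr (a : W) (p : P) :
    (attachPendents H f).Adj (Sum.inl a) (Sum.inr p) ↔ f p = a := Iff.rfl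

@[simp]
theorem attachPendents_adj_inr_inl (a : W) (p : P) :
    (attachPendents H f).Adj (Sum.inr p) (Sum.inl a) ↔ f p = a := Iff.rfl

@[simp]
theorem attachPendents_adj_inr_inr (p q : P) :
    ¬ (attachPendents H f).Adj (Sum.inr p) (Sum.inr q) := fun h => h

theorem attachPendents_connected (hH : H.Connected) : (attachPendents H f).Connected := by
  have hn := hH.nonempty
  let φ : H →g attachPendents H f := ⟨Sum.inl, fun h => h⟩
  have h1 : ∀ a b : W, (attachPendents H f).Reachable (Sum.inl a) (Sum.inl b) :=
    fun a b => (hH.preconnected a b).map φ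
  have h2 : ∀ x : W ⊕ P, ∃ a : W, (attachPendents H f).Reachable x (Sum.inl a) := by
    rintro (a | p)
    · exact ⟨a, Reachable.rfl⟩
    · exact ⟨f p, Adj.reachable (by simp)⟩
  refine (connected_iff _).2 ⟨fun x y => ?_, inferInstance⟩
  obtain ⟨a, ha⟩ := h2 x
  obtain ⟨b, hb⟩ := h2 y
  exact ha.trans ((h1 a b).trans hb.symm)

variable [Fintype W] [Fintype P]

theorem attachPendents_degree_inl (a : W) :
    (attachPendents H f).degree (Sum.inl a)
      = H.degree a + (Finset.univ.filter fun p => f p = a).card := by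
  have h : (attachPendents H f).neighborFinset (Sum.inl a)
      = (H.neighborFinset a).disjSum (Finset.univ.filter fun p => f p = a) := by
    ext x
    rcases x with b | p <;> simp
  rw [← card_neighborFinset_eq_degree, h, Finset.card_disjSum, card_neighborFinset_eq_degree]

theorem attachPendents_degree_inr (p : P) :
    (attachPendents H f).degree (Sum.inr p) = 1 := by
  have h : (attachPendents H f).neighborFinset (Sum.inr p) = {Sum.inl (f p)} := by
    ext x
    rcases x with b | q
    · simp [eq_comm]
    · simp
  rw [← card_neighborFinset_eq_degree, h, Finset.card_singleton]

theorem sum_edgeFinset_attachPendents {M : Type*} [AddCommMonoid M] (φ : Sym2 (W ⊕ P) → M) :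
    ∑ e ∈ (attachPendents H f).edgeFinset, φ e
      = ∑ e ∈ H.edgeFinset, φ (e.map Sum.inl) + ∑ p, φ s(Sum.inl (f p), Sum.inr p) := by
  have h : (attachPendents H f).edgeFinset
      = H.edgeFinset.image (Sym2.map Sum.inl)
        ∪ Finset.univ.image fun p : P => s(Sum.inl (f p), Sum.inr p) := by
    ext e
    induction e with
    | h x y =>
      simp only [mem_edgeFinset, mem_edgeSet, Finset.mem_union, Finset.mem_image,
        Finset.mem_univ, true_and]
      constructor
      · intro h
        rcases x with a | p <;> rcases y with b | q
        · exact Or.inl ⟨s(a, b), h, rfl⟩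
        · exact Or.inr ⟨q, by rw [h]⟩
        · exact Or.inr ⟨p, by rw [h, Sym2.eq_swap]⟩
        · exact h.elim
      · rintro (⟨e, he, h⟩ | ⟨p, h⟩)
        · rw [← mem_edgeSet, ← h]
          induction e with
          | h a b => exact he
        · rw [← mem_edgeSet, ← h]
          simp
  rw [h, Finset.sum_union, Finset.sum_image, Finset.sum_image]
  · intro p _ q _ h
    have h' : f p = f q ∧ p = q := by simpa using h
    exact h'.2
  · exact fun a _ b _ h => Sym2.map.injective Sum.inl_injective h
  · rw [Finset.disjoint_left]
    intro e h1 h2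
    obtain ⟨e', -, rfl⟩ := Finset.mem_image.1 h1
    obtain ⟨p, -, h⟩ := Finset.mem_image.1 h2
    induction e' with
    | h a b => simp at h

theorem card_edgeFinset_attachPendents :
    (attachPendents H f).edgeFinset.card = H.edgeFinset.card + Fintype.card P := by
  have := sum_edgeFinset_attachPendents H f (fun _ => 1)
  simpa using this

theorem attachPendents_mem_bicyclicGraphs (hH : H ∈ bicyclicGraphs W) :
    attachPendents H f ∈ bicyclicGraphs (W ⊕ P) := by
  refine ⟨attachPendents_connected H f hH.1, ?_⟩
  rw [card_edgeFinset_attachPendents, hH.2, Fintype.card_sum]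
  ring

theorem sumConnectivity_attachPendents :
    sumConnectivity (attachPendents H f)
      = ∑ e ∈ H.edgeFinset,
          weight (fun a => H.degree a + (Finset.univ.filter fun p => f p = a).card) e
        + ∑ p, invSqrt (H.degree (f p) + (Finset.univ.filter fun q => f q = f p).card + 1) := by
  rw [sumConnectivity_eq, sum_edgeFinset_attachPendents]
  congr 1
  · refine Finset.sum_congr rfl fun e _ => ?_
    induction e with
    | h a b => simp [attachPendents_degree_inl]
  · refine Finset.sum_congr rfl fun p _ => ?_
    simp [attachPendents_degree_inl, attachPendents_degree_inr]

end attachPendents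

/-- Isomorphic graphs, with pendent vertices attached at corresponding vertices, are
isomorphic. -/
def attachPendentsCongr {W W' P P' : Type*} {H : SimpleGraph W} {H' : SimpleGraph W'}
    {f : P → W} {f' : P' → W'} (e : H ≃g H') (k : P ≃ P') (h : ∀ p, f' (k p) = e (f p)) :
    attachPendents H f ≃g attachPendents H' f' where
  toEquiv := Equiv.sumCongr e.toEquiv k
  map_rel_iff' := by
    rintro (a | p) (b | q)
    · exact e.map_adj_iff
    · simp [h]
    · simp [h]
    · simp

/-- Attaching pendent vertices in two rounds is the same as attaching them in one. -/
def attachPendentsAttach {W P Q : Type*} (H : SimpleGraph W) (f : P → W) (g : Q → W) :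
    attachPendents (attachPendents H f) (fun q => Sum.inl (g q))
      ≃g attachPendents H (Sum.elim f g) where
  toEquiv := Equiv.sumAssoc W P Q
  map_rel_iff' := by
    rintro ((a | p) | q) ((b | r) | s) <;> simp

/-- A pendent vertex `u` of `G` can be detached from its neighbour `v`. -/
theorem exists_iso_attachPendents_induce {V : Type*} (G : SimpleGraph V) {u v : V} (huv : G.Adj u v)
    (hu : ∀ w, G.Adj u w → w = v) :
    ∃ e : attachPendents (G.induce {u}ᶜ) (fun _ : Unit => ⟨v, huv.ne'⟩) ≃g G,
      e (Sum.inl ⟨v, huv.ne'⟩) = v := by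
  let φ : ({u}ᶜ : Set V) ⊕ Unit → V := Sum.elim Subtype.val (fun _ => u)
  have hφ : Function.Bijective φ := by
    constructor
    · rintro (⟨a, ha⟩ | ⟨⟩) (⟨b, hb⟩ | ⟨⟩) h
      · simpa [φ] using h
      · exact (ha h).elim
      · exact (hb h.symm).elim
      · rfl
    · intro w
      by_cases h : w = u
      · exact ⟨Sum.inr (), h.symm⟩
      · exact ⟨Sum.inl ⟨w, h⟩, rfl⟩
  refine ⟨⟨Equiv.ofBijective φ hφ, ?_⟩, rfl⟩
  rintro (⟨a, ha⟩ | ⟨⟩) (⟨b, hb⟩ | ⟨⟩)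
  · simp [φ]
  · simp only [Equiv.ofBijective_apply, φ, Sum.elim_inl, Sum.elim_inr,
      attachPendents_adj_inl_inr]
    exact ⟨fun h => Subtype.ext (hu a h.symm).symm,
      fun h => (Subtype.mk.inj h) ▸ huv.symm⟩
  · simp only [Equiv.ofBijective_apply, φ, Sum.elim_inl, Sum.elim_inr,
      attachPendents_adj_inr_inl]
    exact ⟨fun h => Subtype.ext (hu b h).symm, fun h => (Subtype.mk.inj h) ▸ huv⟩
  · simp [φ]

/-! ### Convexity estimates for 1/√k -/

section invSqrt

theorem invSqrt_four : invSqrt 4 = 1 / 2 := by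
  unfold invSqrt
  rw [show ((4 : ℕ) : ℝ) = 2 ^ 2 by norm_num, Real.sqrt_sq (by norm_num)]

theorem invSqrt_anti {k l : ℕ} (hk : 0 < k) (hkl : k ≤ l) : invSqrt l ≤ invSqrt k := by
  unfold invSqrt
  have h : (k : ℝ) ≤ l := by exact_mod_cast hkl
  gcongr

/-- The graph of `x ↦ 1 / √x` lies above its tangent at `a`. -/
theorem invSqrt_tangent_le {a x : ℕ} (ha : 0 < a) (hx : 0 < x) :
    invSqrt a * (3 * a - x) / (2 * a) ≤ invSqrt x := by
  unfold invSqrt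
  have ha' : 0 < √(a : ℝ) := by positivity
  have hx' : 0 < √(x : ℝ) := by positivity
  have h1 : (a : ℝ) = √(a : ℝ) ^ 2 := by simp
  have h2 : (x : ℝ) = √(x : ℝ) ^ 2 := by simp
  set s := √(a : ℝ)
  set t := √(x : ℝ)
  rw [h1, h2]
  -- With s = √a and t = √x, the cleared inequality is t³ - 3s²t + 2s³ ≥ 0, which factors in this
  -- way.
  have : 0 ≤ (t - s) ^ 2 * (t + 2 * s) := by positivity
  rw [one_div_mul_eq_div, div_div, div_le_div_iff₀ (by positivity) hx']
  nlinarith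

/-- Rationalising the numerator leaves a reciprocal whose factors all increase with m, so positivity
and monotonicity of the differences can be read off. -/
theorem invSqrt_sub_succ {m : ℕ} (hm : 0 < m) :
    invSqrt m - invSqrt (m + 1)
      = 1 / (√(m : ℝ) * √((m + 1 : ℕ) : ℝ) * (√(m : ℝ) + √((m + 1 : ℕ) : ℝ))) := by
  unfold invSqrt
  have ha : 0 < √(m : ℝ) := by positivity
  have hb : 0 < √((m + 1 : ℕ) : ℝ) := by positivity
  have h1 : √(m : ℝ) ^ 2 = m := by simp
  have h2 : √((m + 1 : ℕ) : ℝ) ^ 2 = m + 1 := by rw [Real.sq_sqrt (Nat.cast_nonneg _)]; push_cast; ring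
  set a := √(m : ℝ)
  set b := √((m + 1 : ℕ) : ℝ)
  field_simp
  nlinarith

theorem invSqrt_sub_succ_anti {m k : ℕ} (hm : 0 < m) (hmk : m ≤ k) :
    invSqrt k - invSqrt (k + 1) ≤ invSqrt m - invSqrt (m + 1) := by
  rw [invSqrt_sub_succ hm, invSqrt_sub_succ (hm.trans_le hmk)]
  have h1 : (m : ℝ) ≤ k := by exact_mod_cast hmk
  have h2 : ((m + 1 : ℕ) : ℝ) ≤ ((k + 1 : ℕ) : ℝ) := by exact_mod_cast Nat.succ_le_succ hmk
  have h3 : 0 < √(m : ℝ) := by positivity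
  gcongr

/-- The differences of `1 / √m` decrease slowly. -/
theorem mul_invSqrt_sub_succ_le {m : ℕ} (hm : 0 < m) :
    2 * m * (invSqrt m - invSqrt (m + 1))
      ≤ (2 * m + 3) * (invSqrt (m + 1) - invSqrt (m + 2)) := by
  rw [invSqrt_sub_succ hm, invSqrt_sub_succ m.succ_pos]
  have ha : 0 < √(m : ℝ) := by positivity
  have hb : 0 < √((m + 1 : ℕ) : ℝ) := by positivity
  have hc : 0 < √((m + 1 + 1 : ℕ) : ℝ) := by positivity
  have h1 : √(m : ℝ) ^ 2 = m := by simp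
  have h2 : √((m + 1 : ℕ) : ℝ) ^ 2 = m + 1 := by rw [Real.sq_sqrt (Nat.cast_nonneg _)]; push_cast; ring
  have h3 : √((m + 1 + 1 : ℕ) : ℝ) ^ 2 = m + 2 := by
    rw [Real.sq_sqrt (Nat.cast_nonneg _)]; push_cast; ring
  set a := √(m : ℝ)
  set b := √((m + 1 : ℕ) : ℝ)
  set c := √((m + 1 + 1 : ℕ) : ℝ)
  -- Both bounds are AM-GM; here a² + c² = 2b².
  have hac : a * c ≤ b ^ 2 := by nlinarith [sq_nonneg (a - c)]
  have hbc : 2 * (b * c) ≤ 2 * m + 3 := by nlinarith [sq_nonneg (b - c)]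
  have key : 2 * m * (c * (b + c)) ≤ (2 * m + 3) * (a * (a + b)) := by
    have e1 : a * (b + c) ≤ b * (a + b) := by nlinarith
    calc 2 * m * (c * (b + c)) = 2 * a * c * (a * (b + c)) := by rw [← h1]; ring
      _ ≤ 2 * a * c * (b * (a + b)) := by gcongr
      _ = 2 * (b * c) * (a * (a + b)) := by ring
      _ ≤ (2 * m + 3) * (a * (a + b)) := by gcongr
  rw [mul_one_div, mul_one_div, div_le_div_iff₀ (by positivity) (by positivity)]
  calc 2 * m * (b * c * (b + c)) = b * (2 * m * (c * (b + c))) := by ring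
    _ ≤ b * ((2 * m + 3) * (a * (a + b))) := by gcongr
    _ = (2 * m + 3) * (a * b * (a + b)) := by ring

end invSqrt

/-! ### Sums over edges and graphs without pendent vertices -/

section edgeSums

variable {V : Type*} [Fintype V] (G : SimpleGraph V)

theorem sum_edgeFinset_eq_add (v : V) {M : Type*} [AddCommMonoid M] (φ : Sym2 V → M) :
    ∑ e ∈ G.edgeFinset, φ e
      = ∑ w ∈ G.neighborFinset v, φ s(v, w) + ∑ e ∈ G.edgeFinset with v ∉ e, φ e := by
  have h : G.edgeFinset.filter (v ∈ ·) = (G.neighborFinset v).image (s(v, ·)) := by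
    ext e
    induction e with
    | h a b =>
      simp only [Finset.mem_filter, mem_edgeFinset, mem_edgeSet, Sym2.mem_iff, Finset.mem_image,
        mem_neighborFinset]
      constructor
      · rintro ⟨h, rfl | rfl⟩
        · exact ⟨b, h, rfl⟩
        · exact ⟨a, h.symm, Sym2.eq_swap⟩
      · rintro ⟨w, hw, h⟩
        rcases Sym2.eq_iff.1 h with ⟨rfl, rfl⟩ | ⟨rfl, rfl⟩
        · exact ⟨hw, Or.inl rfl⟩
        · exact ⟨hw.symm, Or.inr rfl⟩
  rw [← Finset.sum_filter_add_sum_filter_not _ (v ∈ ·), h, Finset.sum_image]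
  intro a _ b _ h
  rcases Sym2.eq_iff.1 h with ⟨-, h⟩ | ⟨h, h'⟩
  · exact h
  · exact h'.trans h

theorem card_edgeFinset_eq_add (v : V) :
    G.edgeFinset.card = G.degree v + (G.edgeFinset.filter (v ∉ ·)).card := by
  have := sum_edgeFinset_eq_add G v (fun _ => 1)
  simpa using this

/-- Double counting of incidences: an edge weight bounded below by a sum of vertex charges gives a
bound by a degree sum. -/
theorem sum_degree_mul_le {F : Sym2 V → ℝ} {h : V → ℝ}
    (hF : ∀ u v, G.Adj u v → h u + h v ≤ F s(u, v)) :
    ∑ v, G.degree v * h v ≤ ∑ e ∈ G.edgeFinset, F e := by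
  have h1 : ∀ v, G.degree v * h v = ∑ e ∈ G.edgeFinset, if v ∈ e then h v else 0 := by
    intro v
    rw [← Finset.sum_filter, Finset.sum_const, ← card_incidenceFinset_eq_degree,
      incidenceFinset_eq_filter, nsmul_eq_mul]
  simp_rw [h1]
  rw [Finset.sum_comm]
  refine Finset.sum_le_sum fun e he => ?_
  induction e with
  | h a b =>
    have hab : G.Adj a b := by simpa using he
    have h2 : Finset.univ.filter (· ∈ s(a, b)) = {a, b} := by
      ext x
      simp
    rw [← Finset.sum_filter, h2, Finset.sum_pair hab.ne]
    exact hF a b hab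

theorem sum_degree_of_mem_bicyclicGraphs {G : SimpleGraph V} (hG : G ∈ bicyclicGraphs V) :
    ∑ v, G.degree v = 2 * (Fintype.card V + 1) := by
  rw [sum_degrees_eq_twice_card_edges, ← hG.2]

/-- A bicyclic graph without pendent vertices has a large sum-connectivity index. -/
theorem le_sumConnectivity_of_two_le_degree {G : SimpleGraph V} (hG : G ∈ bicyclicGraphs V)
    (h2 : ∀ v, 2 ≤ G.degree v) {k : ℕ} (hk : ∀ v, G.degree v ≤ k + 2) :
    ((Fintype.card V : ℝ) + 1) / 2 - ((k : ℝ) + 2) / 8 ≤ sumConnectivity G := by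
  rw [sumConnectivity_eq]
  have hs : ∑ v, (G.degree v : ℝ) = 2 * (Fintype.card V + 1) := by
    exact_mod_cast sum_degree_of_mem_bicyclicGraphs hG
  -- The tangent to 1/√x at x = 4 is (12 - x)/16, which splits into one charge per endpoint. The
  -- resulting concave function of the degree is bounded below by its chord over [2, k + 2], so only
  -- the degree sum matters.
  refine le_trans ?_ (sum_degree_mul_le G (h := fun v => (6 - (G.degree v : ℝ)) / 16) ?_)
  · have h3 : ∀ v, ((2 - (k : ℝ)) * G.degree v + 2 * (k + 2)) / 16
        ≤ G.degree v * ((6 - (G.degree v : ℝ)) / 16) := by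
      intro v
      have e1 : (2 : ℝ) ≤ G.degree v := by exact_mod_cast h2 v
      have e2 : (G.degree v : ℝ) ≤ k + 2 := by exact_mod_cast hk v
      nlinarith [mul_nonneg (sub_nonneg.2 e1) (sub_nonneg.2 e2)]
    refine le_trans (le_of_eq ?_) (Finset.sum_le_sum fun v _ => h3 v)
    rw [← Finset.sum_div, Finset.sum_add_distrib, ← Finset.mul_sum, hs]
    simp only [Finset.sum_const, Finset.card_univ, nsmul_eq_mul]
    ring
  · intro u v _
    rw [weight_mk]
    refine le_trans (le_of_eq ?_) (invSqrt_tangent_le (a := 4) (x := G.degree u + G.degree v)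
      (by norm_num) (by have := h2 u; omega))
    rw [invSqrt_four]
    push_cast
    ring

end edgeSums

/-! ### Attaching one pendent vertex -/

/-- A lower bound for the increase of the sum-connectivity index when a pendent vertex is attached
to a vertex whose degree becomes `d`. -/
def pendentGain (d : ℕ) : ℝ :=
  invSqrt (d + 2) - ((d : ℝ) - 2) * (invSqrt d - invSqrt (d + 1))

/-- Only edges at `v` change. Each loses at most the difference computed for a neighbour of degree
1, and the edge to `w` loses at most the smaller difference for degree 2. The last term cancels
against the new edge, which leaves `pendentGain`. -/
theorem add_pendentGain_le {W : Type*} [Fintype W] (H : SimpleGraph W) {v w : W}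
    (hvw : H.Adj v w) (hw : 2 ≤ H.degree w) :
    sumConnectivity H + pendentGain (H.degree v + 1)
      ≤ sumConnectivity (attachPendents H (fun _ : Unit => v)) := by
  have hc : ∀ a, (Finset.univ.filter fun _ : Unit => v = a).card = if v = a then 1 else 0 := by
    intro a
    split_ifs with h <;> simp [h]
  rw [sumConnectivity_attachPendents, sumConnectivity_eq]
  simp only [hc, Finset.filter_true, Finset.card_univ, Fintype.card_unit, Finset.sum_const,
    one_smul]
  rw [sum_edgeFinset_eq_add H v, sum_edgeFinset_eq_add H v]
  have h0 : ∀ e ∈ H.edgeFinset.filter (v ∉ ·),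
      weight (fun a => H.degree a + if v = a then 1 else 0) e = weight (fun a => H.degree a) e := by
    intro e he
    have he := (Finset.mem_filter.1 he).2
    induction e with
    | h a b =>
      simp only [Sym2.mem_iff, not_or] at he
      simp [he.1, he.2]
  have h0 : ∑ e ∈ H.edgeFinset with v ∉ e,
      weight (fun a => H.degree a + if v = a then 1 else 0) e
      = ∑ e ∈ H.edgeFinset with v ∉ e, weight (fun a => H.degree a) e := Finset.sum_congr rfl h0
  rw [h0]
  have hpos : ∀ x ∈ H.neighborFinset v, 1 ≤ H.degree x := by
    intro x hx
    exact (H.degree_pos_iff_exists_adj x).2 ⟨v, ((H.mem_neighborFinset v x).1 hx).symm⟩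
  have hne : ∀ x ∈ H.neighborFinset v, v ≠ x := fun x hx => ((H.mem_neighborFinset v x).1 hx).ne
  have hw' : w ∈ H.neighborFinset v := by simpa using hvw
  have h1 : ∑ x ∈ H.neighborFinset v, (invSqrt (H.degree v + H.degree x)
      - invSqrt (H.degree v + H.degree x + 1))
      ≤ ((H.degree v : ℝ) - 1) * (invSqrt (H.degree v + 1) - invSqrt (H.degree v + 2))
        + (invSqrt (H.degree v + 2) - invSqrt (H.degree v + 3)) := by
    rw [← Finset.sum_erase_add _ _ hw']
    refine add_le_add ?_ (invSqrt_sub_succ_anti (by omega) (by omega))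
    refine (Finset.sum_le_card_nsmul _ _ (invSqrt (H.degree v + 1) - invSqrt (H.degree v + 2))
      fun x hx => ?_).trans (le_of_eq ?_)
    · have := hpos x (Finset.mem_of_mem_erase hx)
      exact invSqrt_sub_succ_anti (by omega) (by omega)
    · rw [Finset.card_erase_of_mem hw', card_neighborFinset_eq_degree, nsmul_eq_mul,
        Nat.cast_sub ((H.degree_pos_iff_exists_adj v).2 ⟨w, hvw⟩), Nat.cast_one]
  have h2 : ∑ x ∈ H.neighborFinset v,
      weight (fun a => H.degree a + if v = a then 1 else 0) s(v, x)
      = ∑ x ∈ H.neighborFinset v, invSqrt (H.degree v + H.degree x + 1) := by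
    refine Finset.sum_congr rfl fun x hx => ?_
    simp [hne x hx, add_right_comm]
  rw [h2]
  rw [Finset.sum_sub_distrib] at h1
  simp only [weight_mk]
  unfold pendentGain
  push_cast
  linarith

/-- Otherwise no walk from `v` leaves its closed neighbourhood, so by connectedness every other
vertex has degree at most 1. The degree sum is then too small for n + 1 edges. -/
theorem exists_adj_two_le_degree {W : Type*} [Fintype W] {H : SimpleGraph W}
    (hH : H ∈ bicyclicGraphs W) (v : W) : ∃ w, H.Adj v w ∧ 2 ≤ H.degree w := by
  by_contra! hcon
  have hclosed : ∀ a b : W, H.Walk a b → (a = v ∨ H.Adj v a) → (b = v ∨ H.Adj v b) := by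
    intro a b p
    induction p with
    | nil => exact id
    | cons h p ih =>
      rename_i x y z
      intro hx
      refine ih ?_
      rcases hx with rfl | hx
      · exact Or.inr h
      · left
        by_contra hy
        have h2 := hcon x hx
        have : ({y, v} : Finset W) ⊆ H.neighborFinset x := by
          intro t ht
          rcases Finset.mem_insert.1 ht with rfl | ht
          · simpa using h
          · rw [Finset.mem_singleton.1 ht]
            simpa using hx.symm
        have h3 := Finset.card_le_card this
        rw [Finset.card_pair hy, card_neighborFinset_eq_degree] at h3
        omega
  have hall : ∀ w, w ≠ v → H.degree w ≤ 1 := by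
    intro w hw
    obtain ⟨p⟩ := hH.1.preconnected v w
    have := hcon w ((hclosed v w p (Or.inl rfl)).resolve_left hw)
    omega
  have h1 := sum_degree_of_mem_bicyclicGraphs hH
  rw [← Finset.add_sum_erase _ _ (Finset.mem_univ v)] at h1
  have h2 : ∑ w ∈ Finset.univ.erase v, H.degree w ≤ _ :=
    Finset.sum_le_card_nsmul _ _ 1 fun w hw => hall w (Finset.ne_of_mem_erase hw)
  rw [Finset.card_erase_of_mem (Finset.mem_univ v), Finset.card_univ, smul_eq_mul, mul_one] at h2
  have := H.degree_lt_card_verts v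
  omega

/-! ### Graphs with a vertex adjacent to all others -/

/-- A graph in which all vertices outside a copy of `H₀` are pendent vertices at the same vertex
of that copy. -/
theorem exists_iso_attachPendents {W W₀ : Type*} [Fintype W] [Fintype W₀] {H : SimpleGraph W}
    {H₀ : SimpleGraph W₀} {t : W₀ → W} {k : ℕ} {i₀ : W₀} (ht : Function.Injective t)
    (hcard : Fintype.card W = Fintype.card W₀ + k)
    (hadj : ∀ i j, H.Adj (t i) (t j) ↔ H₀.Adj i j)
    (hout : ∀ w, w ∉ Set.range t → ∀ x, H.Adj w x ↔ x = t i₀) :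
    ∃ φ : H ≃g attachPendents H₀ (fun _ : Fin k => i₀), ∀ i, φ (t i) = Sum.inl i := by
  have hk : Fintype.card {w // w ∉ Set.range t} = k := by
    have h1 := Fintype.card_subtype_compl (fun w => w ∈ Set.range t)
    have h2 : Fintype.card {w // w ∈ Set.range t} = Fintype.card W₀ :=
      (Fintype.card_congr (Equiv.ofInjective t ht)).symm
    rw [h1, h2, hcard]
    omega
  let e : Fin k ≃ {w // w ∉ Set.range t} := (Fintype.equivFinOfCardEq hk).symm
  let ψ : W₀ ⊕ Fin k → W := Sum.elim t (fun p => (e p).1)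
  have hψ : Function.Bijective ψ := by
    constructor
    · rintro (i | p) (j | q) h
      · exact congrArg _ (ht h)
      · exact ((e q).2 ⟨i, h⟩).elim
      · exact ((e p).2 ⟨j, h.symm⟩).elim
      · exact congrArg _ (e.injective (Subtype.ext h))
    · intro w
      by_cases h : w ∈ Set.range t
      · obtain ⟨i, rfl⟩ := h
        exact ⟨Sum.inl i, rfl⟩
      · exact ⟨Sum.inr (e.symm ⟨w, h⟩), by simp [ψ]⟩
  let χ : attachPendents H₀ (fun _ : Fin k => i₀) ≃g H := by
    refine ⟨Equiv.ofBijective ψ hψ, ?_⟩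
    rintro (i | p) (j | q)
    · exact hadj i j
    · change H.Adj (t i) (e q).1 ↔ i₀ = i
      rw [H.adj_comm, hout _ (e q).2, ht.eq_iff, eq_comm]
    · change H.Adj (e p).1 (t j) ↔ i₀ = j
      rw [hout _ (e p).2, ht.eq_iff, eq_comm]
    · change H.Adj (e p).1 (e q).1 ↔ False
      rw [hout _ (e p).2, iff_false]
      intro h
      exact (e q).2 ⟨i₀, h.symm⟩
  exact ⟨χ.symm, fun i => χ.symm_apply_eq.2 rfl⟩

/-- A vertex adjacent to all others, and two more edges: the graph is a diamond or a bowtie, with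
pendent vertices at one vertex. -/
theorem iso_of_degree_add_one_eq_card {W : Type*} [Fintype W] {H : SimpleGraph W}
    (hH : H ∈ bicyclicGraphs W) {c : W} (hc : H.degree c + 1 = Fintype.card W) :
    (4 ≤ Fintype.card W ∧
      ∃ φ : H ≃g attachPendents diamond (fun _ : Fin (Fintype.card W - 4) => 0),
        φ c = Sum.inl 0) ∨
    (5 ≤ Fintype.card W ∧
      ∃ φ : H ≃g attachPendents bowtie (fun _ : Fin (Fintype.card W - 5) => 0),
        φ c = Sum.inl 0) := by
  have hcu : ∀ w, w ≠ c → H.Adj c w := by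
    have h1 : H.neighborFinset c = Finset.univ.erase c := by
      refine Finset.eq_of_subset_of_card_le ?_ ?_
      · intro w hw
        simpa using ((H.mem_neighborFinset c w).1 hw).ne'
      · rw [Finset.card_erase_of_mem (Finset.mem_univ c), Finset.card_univ,
          card_neighborFinset_eq_degree]
        omega
    intro w hw
    rw [← mem_neighborFinset, h1]
    simpa using hw
  have h2 : (H.edgeFinset.filter (c ∉ ·)).card = 2 := by
    have h3 := card_edgeFinset_eq_add H c
    have h4 : H.edgeFinset.card = Fintype.card W + 1 := hH.2
    omega
  obtain ⟨e₁, e₂, hne, he⟩ := Finset.card_eq_two.1 h2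
  have hadj : ∀ a b, H.Adj a b ↔ (a ≠ b ∧ (a = c ∨ b = c)) ∨ s(a, b) = e₁ ∨ s(a, b) = e₂ := by
    intro a b
    have h5 : s(a, b) ∈ H.edgeFinset.filter (c ∉ ·) ↔ s(a, b) = e₁ ∨ s(a, b) = e₂ := by
      simp [he]
    rw [← h5]
    simp only [Finset.mem_filter, mem_edgeFinset, mem_edgeSet, Sym2.mem_iff, not_or]
    constructor
    · intro h
      by_cases hac : a = c
      · exact Or.inl ⟨h.ne, Or.inl hac⟩
      by_cases hbc : b = c
      · exact Or.inl ⟨h.ne, Or.inr hbc⟩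
      · exact Or.inr ⟨h, Ne.symm hac, Ne.symm hbc⟩
    · rintro (⟨h, rfl | rfl⟩ | h)
      · exact hcu _ h.symm
      · exact (hcu _ h).symm
      · exact h.1
  have hmem : ∀ e, e = e₁ ∨ e = e₂ → e ∈ H.edgeFinset ∧ c ∉ e := by
    intro e h
    have : e ∈ H.edgeFinset.filter (c ∉ ·) := by simpa [he] using h
    simpa using this
  -- The two edges avoiding `c` share the endpoint `x`: then `c` and `x` are the degree-three
  -- vertices of the diamond.
  have hdiamond : ∀ x y z, e₁ = s(x, y) → e₂ = s(x, z) → 4 ≤ Fintype.card W ∧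
      ∃ φ : H ≃g attachPendents diamond (fun _ : Fin (Fintype.card W - 4) => 0),
        φ c = Sum.inl 0 := by
    rintro x y z rfl rfl
    have m1 := hmem _ (Or.inl rfl)
    have m2 := hmem _ (Or.inr rfl)
    simp only [mem_edgeFinset, mem_edgeSet, Sym2.mem_iff, not_or] at m1 m2
    obtain ⟨hxy, hcx, hcy⟩ := m1
    obtain ⟨hxz, -, hcz⟩ := m2
    have hyz : y ≠ z := fun h => hne (by rw [h])
    have hxy := hxy.ne
    have hxz := hxz.ne
    let t : Fin 4 → W := ![c, x, y, z]
    have ht : Function.Injective t := by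
      intro i j
      fin_cases i <;> fin_cases j <;>
        simp [t, hcx, hcy, hcz, hxy, hxz, hyz, Ne.symm hcx, Ne.symm hcy, Ne.symm hcz, hxy.symm, hxz.symm,
          hyz.symm]
    have h4 : 4 ≤ Fintype.card W := by simpa using Fintype.card_le_of_injective t ht
    obtain ⟨φ, hφ⟩ := exists_iso_attachPendents (H := H) (H₀ := diamond) (t := t)
      (k := Fintype.card W - 4) (i₀ := 0) ht (by simp; omega) (by
        intro i j
        fin_cases i <;> fin_cases j <;>
          simp [t, hadj, diamond, hcx, hcy, hcz, hxy, hxz, hyz, Ne.symm hcx, Ne.symm hcy,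
            Ne.symm hcz, hxy.symm, hxz.symm, hyz.symm]) (by
        intro w hw u
        have k0 : w ≠ c := fun h => hw ⟨0, h.symm⟩
        have k1 : w ≠ x := fun h => hw ⟨1, h.symm⟩
        have k2 : w ≠ y := fun h => hw ⟨2, h.symm⟩
        have k3 : w ≠ z := fun h => hw ⟨3, h.symm⟩
        simp only [hadj, Sym2.eq_iff, k0, k1, k2, k3, false_and, false_or, or_false]
        exact ⟨fun h => h.2, fun h => ⟨h ▸ k0, h⟩⟩)
    exact ⟨h4, φ, hφ 0⟩
  obtain ⟨p, q, rfl⟩ : ∃ p q, e₁ = s(p, q) := by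
    induction e₁ with
    | h p q => exact ⟨p, q, rfl⟩
  obtain ⟨r, s, rfl⟩ : ∃ r s, e₂ = s(r, s) := by
    induction e₂ with
    | h p q => exact ⟨p, q, rfl⟩
  by_cases hpr : p = r
  · exact Or.inl (hdiamond p q s rfl (by rw [hpr]))
  by_cases hps : p = s
  · exact Or.inl (hdiamond p q r rfl (by rw [hps, Sym2.eq_swap]))
  by_cases hqr : q = r
  · exact Or.inl (hdiamond q p s Sym2.eq_swap (by rw [hqr]))
  by_cases hqs : q = s
  · exact Or.inl (hdiamond q p r Sym2.eq_swap (by rw [hqs, Sym2.eq_swap]))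
  right
  have m1 := hmem _ (Or.inl rfl)
  have m2 := hmem _ (Or.inr rfl)
  simp only [mem_edgeFinset, mem_edgeSet, Sym2.mem_iff, not_or] at m1 m2
  obtain ⟨hpq, hcp, hcq⟩ := m1
  obtain ⟨hrs, hcr, hcs⟩ := m2
  have hpq := hpq.ne
  have hrs := hrs.ne
  let t : Fin 5 → W := ![c, p, q, r, s]
  have ht : Function.Injective t := by
    intro i j
    fin_cases i <;> fin_cases j <;>
      simp [t, hcp, hcq, hcr, hcs, hpq, hrs, hpr, hps, hqr, hqs, Ne.symm hcp, Ne.symm hcq, Ne.symm hcr,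
        Ne.symm hcs, hpq.symm, hrs.symm, Ne.symm hpr, Ne.symm hps, Ne.symm hqr, Ne.symm hqs]
  have h5 : 5 ≤ Fintype.card W := by simpa using Fintype.card_le_of_injective t ht
  obtain ⟨φ, hφ⟩ := exists_iso_attachPendents (H := H) (H₀ := bowtie) (t := t)
    (k := Fintype.card W - 5) (i₀ := 0) ht (by simp; omega) (by
      intro i j
      fin_cases i <;> fin_cases j <;>
        simp [t, hadj, bowtie, hcp, hcq, hcr, hcs, hpq, hrs, hpr, hps, hqr, hqs, Ne.symm hcp,
          Ne.symm hcq, Ne.symm hcr, Ne.symm hcs, hpq.symm, hrs.symm, Ne.symm hpr, Ne.symm hps,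
          Ne.symm hqr, Ne.symm hqs]) (by
      intro w hw u
      have k0 : w ≠ c := fun h => hw ⟨0, h.symm⟩
      have k1 : w ≠ p := fun h => hw ⟨1, h.symm⟩
      have k2 : w ≠ q := fun h => hw ⟨2, h.symm⟩
      have k3 : w ≠ r := fun h => hw ⟨3, h.symm⟩
      have k4 : w ≠ s := fun h => hw ⟨4, h.symm⟩
      simp only [hadj, Sym2.eq_iff, k0, k1, k2, k3, k4, false_and, false_or, or_false]
      exact ⟨fun h => h.2, fun h => ⟨h ▸ k0, h⟩⟩)
  exact ⟨h5, φ, hφ 0⟩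

theorem connected_of_forall_adj {V : Type*} {G : SimpleGraph V} (c : V)
    (h : ∀ w, w ≠ c → G.Adj c w) : G.Connected := by
  refine connected_iff_exists_forall_reachable _ |>.2 ⟨c, fun w => ?_⟩
  by_cases hw : w = c
  · exact hw ▸ Reachable.rfl
  · exact (h w hw).reachable

theorem sumConnectivity_attachPendents_of_card {W P : Type*} [Fintype W] [Fintype P]
    (H : SimpleGraph W) (f : P → W) {D k : W → ℕ} (hD : ∀ a, H.degree a = D a)
    (hk : ∀ a, Nat.card {p // f p = a} = k a) :
    sumConnectivity (attachPendents H f)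
      = ∑ e ∈ H.edgeFinset, weight (fun a => D a + k a) e
        + ∑ p, invSqrt (D (f p) + k (f p) + 1) := by
  have h : ∀ a, (Finset.univ.filter fun p => f p = a).card = k a := by
    intro a
    rw [← hk a, Nat.card_eq_fintype_card, Fintype.card_subtype]
  rw [sumConnectivity_attachPendents]
  simp only [h, hD]

/-! ### The named graphs and their indices -/

section diamond

theorem edgeFinset_diamond :
    diamond.edgeFinset = {s(0, 1), s(0, 2), s(0, 3), s(1, 2), s(1, 3)} := by
  ext e
  rw [mem_edgeFinset]
  simp [diamond]
  rintro (rfl | rfl | rfl | rfl | rfl) <;> simp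

theorem sum_edgeFinset_diamond {M : Type*} [AddCommMonoid M] (φ : Sym2 (Fin 4) → M) :
    ∑ e ∈ diamond.edgeFinset, φ e
      = φ s(0, 1) + (φ s(0, 2) + (φ s(0, 3) + (φ s(1, 2) + φ s(1, 3)))) := by
  rw [edgeFinset_diamond, Finset.sum_insert (by simp), Finset.sum_insert (by simp),
    Finset.sum_insert (by simp), Finset.sum_insert (by simp), Finset.sum_singleton]

theorem diamond_mem_bicyclicGraphs : diamond ∈ bicyclicGraphs (Fin 4) := by
  refine ⟨connected_of_forall_adj 0 ?_, ?_⟩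
  · intro w hw
    fin_cases w <;> simp [diamond] at hw ⊢
  · have := sum_edgeFinset_diamond (fun _ => 1)
    simpa using this

theorem degree_diamond (a : Fin 4) : diamond.degree a = ![3, 3, 2, 2] a := by
  rw [← card_neighborFinset_eq_degree,
    show diamond.neighborFinset a = ![{1, 2, 3}, {0, 2, 3}, {0, 1}, {0, 1}] a by
      ext x
      rw [mem_neighborFinset]
      fin_cases a <;> fin_cases x <;> simp [diamond]]
  fin_cases a <;> simp

end diamond

section bowtie

theorem edgeFinset_bowtie :
    bowtie.edgeFinset = {s(0, 1), s(0, 2), s(1, 2), s(0, 3), s(0, 4), s(3, 4)} := by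
  ext e
  rw [mem_edgeFinset]
  simp [bowtie]
  rintro (rfl | rfl | rfl | rfl | rfl | rfl) <;> simp

theorem sum_edgeFinset_bowtie {M : Type*} [AddCommMonoid M] (φ : Sym2 (Fin 5) → M) :
    ∑ e ∈ bowtie.edgeFinset, φ e
      = φ s(0, 1) + (φ s(0, 2) + (φ s(1, 2) + (φ s(0, 3) + (φ s(0, 4) + φ s(3, 4))))) := by
  rw [edgeFinset_bowtie, Finset.sum_insert (by simp), Finset.sum_insert (by simp),
    Finset.sum_insert (by simp), Finset.sum_insert (by simp), Finset.sum_insert (by simp),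
    Finset.sum_singleton]

theorem bowtie_mem_bicyclicGraphs : bowtie ∈ bicyclicGraphs (Fin 5) := by
  refine ⟨connected_of_forall_adj 0 ?_, ?_⟩
  · intro w hw
    fin_cases w <;> simp [bowtie] at hw ⊢
  · have := sum_edgeFinset_bowtie (fun _ => 1)
    simpa using this

theorem degree_bowtie (a : Fin 5) : bowtie.degree a = ![4, 2, 2, 2, 2] a := by
  rw [← card_neighborFinset_eq_degree,
    show bowtie.neighborFinset a = ![{1, 2, 3, 4}, {0, 2}, {0, 1}, {0, 4}, {0, 3}] a by
      ext x
      rw [mem_neighborFinset]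
      fin_cases a <;> fin_cases x <;> simp [bowtie]]
  fin_cases a <;> simp

end bowtie

theorem graphB_mem_bicyclicGraphs (a b : ℕ) : graphB a b ∈ bicyclicGraphs _ :=
  attachPendents_mem_bicyclicGraphs _ _ diamond_mem_bicyclicGraphs

theorem graphBThree_mem_bicyclicGraphs (n : ℕ) : graphBThree n ∈ bicyclicGraphs _ :=
  attachPendents_mem_bicyclicGraphs _ _ bowtie_mem_bicyclicGraphs

theorem graphFive_mem_bicyclicGraphs : graphFive ∈ bicyclicGraphs _ :=
  attachPendents_mem_bicyclicGraphs _ _ diamond_mem_bicyclicGraphs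

theorem sumConnectivity_graphB {a b : ℕ} (ha : 3 ≤ a) (hb : 3 ≤ b) :
    sumConnectivity (graphB a b) = invSqrt (a + b) + 2 * invSqrt (a + 2) + 2 * invSqrt (b + 2)
      + ((a : ℝ) - 3) * invSqrt (a + 1) + ((b : ℝ) - 3) * invSqrt (b + 1) := by
  have hc : ∀ i : Fin 4, Nat.card {p : Fin (a - 3) ⊕ Fin (b - 3) //
      Sum.elim (fun _ => (0 : Fin 4)) (fun _ => 1) p = i} = ![a - 3, b - 3, 0, 0] i := by
    intro i
    rw [Nat.card_eq_fintype_card, Fintype.card_subtype, Finset.card_filter, Fintype.sum_sum_type]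
    fin_cases i <;> simp
  unfold graphB
  rw [sumConnectivity_attachPendents_of_card _ _ degree_diamond hc, sum_edgeFinset_diamond, Fintype.sum_sum_type]
  simp only [weight_mk, Sum.elim_inl, Sum.elim_inr, Finset.sum_const,
    Finset.card_univ, Fintype.card_fin, nsmul_eq_mul]
  obtain ⟨a, rfl⟩ := Nat.exists_eq_add_of_le ha
  obtain ⟨b, rfl⟩ := Nat.exists_eq_add_of_le hb
  simp
  ring

theorem sumConnectivity_graphBThree {n : ℕ} (hn : 5 ≤ n) :
    sumConnectivity (graphBThree n) = 4 * invSqrt (n + 1) + ((n : ℝ) - 5) * invSqrt n + 1 := by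
  have hc : ∀ i : Fin 5, Nat.card {_p : Fin (n - 5) // (0 : Fin 5) = i}
      = ![n - 5, 0, 0, 0, 0] i := by
    intro i
    rw [Nat.card_eq_fintype_card, Fintype.card_subtype, Finset.card_filter]
    fin_cases i <;> simp
  unfold graphBThree
  rw [sumConnectivity_attachPendents_of_card _ _ degree_bowtie hc, sum_edgeFinset_bowtie]
  simp only [weight_mk, Finset.sum_const,
    Finset.card_univ, Fintype.card_fin, nsmul_eq_mul]
  obtain ⟨n, rfl⟩ := Nat.exists_eq_add_of_le hn
  simp [invSqrt_four]
  ring_nf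

theorem sumConnectivity_graphFive :
    sumConnectivity graphFive = 3 * invSqrt 6 + 2 * invSqrt 5 + 1 / 2 := by
  have hc : ∀ i : Fin 4, Nat.card {_p : Fin 1 // (2 : Fin 4) = i}
      = ![0, 0, 1, 0] i := by
    intro i
    rw [Nat.card_eq_fintype_card, Fintype.card_subtype, Finset.card_filter]
    fin_cases i <;> simp
  unfold graphFive
  rw [sumConnectivity_attachPendents_of_card _ _ degree_diamond hc, sum_edgeFinset_diamond]
  simp only [weight_mk, Finset.sum_const,
    Finset.card_univ, Fintype.card_fin, nsmul_eq_mul]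
  simp [invSqrt_four]
  ring

/-! ### Numerical bounds and monotonicity of the gain -/

theorem invSqrt_bounds {k : ℕ} (hk : 0 < k) {l u : ℝ} (hu : 0 < u)
    (hl' : l ^ 2 * k < 1) (hu' : 1 < u ^ 2 * k) : l < invSqrt k ∧ invSqrt k < u := by
  have hk' : (0 : ℝ) < k := by exact_mod_cast hk
  have hs : 0 < √(k : ℝ) := by positivity
  have h1 : √(k : ℝ) ^ 2 = k := by simp
  unfold invSqrt
  constructor
  · rw [lt_div_iff₀ hs]
    by_contra! h
    nlinarith
  · rw [div_lt_iff₀ hs]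
    by_contra! h
    nlinarith [mul_pos hu hs]

theorem invSqrt_three : 0.577350 < invSqrt 3 ∧ invSqrt 3 < 0.577351 :=
  invSqrt_bounds (by norm_num) (by norm_num) (by norm_num) (by norm_num)

theorem invSqrt_five : 0.447213 < invSqrt 5 ∧ invSqrt 5 < 0.447214 :=
  invSqrt_bounds (by norm_num) (by norm_num) (by norm_num) (by norm_num)

theorem invSqrt_six : 0.408248 < invSqrt 6 ∧ invSqrt 6 < 0.408249 :=
  invSqrt_bounds (by norm_num) (by norm_num) (by norm_num) (by norm_num)

theorem invSqrt_seven : 0.377964 < invSqrt 7 ∧ invSqrt 7 < 0.377965 :=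
  invSqrt_bounds (by norm_num) (by norm_num) (by norm_num) (by norm_num)

theorem invSqrt_eight : 0.353553 < invSqrt 8 ∧ invSqrt 8 < 0.353554 :=
  invSqrt_bounds (by norm_num) (by norm_num) (by norm_num) (by norm_num)

theorem invSqrt_nine : 0.333333 < invSqrt 9 ∧ invSqrt 9 < 0.333334 :=
  invSqrt_bounds (by norm_num) (by norm_num) (by norm_num) (by norm_num)

theorem pendentGain_succ_le {d : ℕ} (hd : 2 ≤ d) : pendentGain (d + 1) ≤ pendentGain d := by
  have h1 := mul_invSqrt_sub_succ_le (m := d) (by omega)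
  have h2 := mul_invSqrt_sub_succ_le (m := d + 1) (by omega)
  have h3 : invSqrt (d + 1) ≤ invSqrt d := invSqrt_anti (by omega) (by omega)
  have hd' : (2 : ℝ) ≤ d := by exact_mod_cast hd
  unfold pendentGain
  simp only [add_assoc] at h2 ⊢
  norm_num at h2 ⊢
  set x := invSqrt d - invSqrt (d + 1) with hx
  set y := invSqrt (d + 1) - invSqrt (d + 2) with hy
  set z := invSqrt (d + 2) - invSqrt (d + 3) with hz
  have hx0 : 0 ≤ x := by linarith
  -- This is exactly the drop of `pendentGain` from d to d + 1 being nonnegative. After multiplying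
  -- by (2d + 3)(2d + 5), the ratio bounds eliminate z and then y, leaving the nonnegative multiple
  -- of x in `e2`.
  have key : ((d : ℝ) - 2) * x ≤ (d - 1) * y + z := by
    have e1 : 0 ≤ (2 * (d : ℝ) + 5) * ((2 * d + 3) * ((d - 1) * y + z - (d - 2) * x)) := by
      have e2 : 0 ≤ (2 * (d : ℝ) ^ 2 + 11 * d + 30) * x := by positivity
      have e3 : 0 ≤ (2 * (d : ℝ) ^ 2 + 5 * d - 3) * ((2 * d + 3) * y - 2 * d * x) :=
        mul_nonneg (by nlinarith) (by linarith)
      have e4 : 0 ≤ (2 * (d : ℝ) + 3) * ((2 * d + 5) * z - (2 * d + 2) * y) :=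
        mul_nonneg (by positivity) (by linarith)
      nlinarith
    have e5 := nonneg_of_mul_nonneg_right e1 (by positivity)
    have e6 := nonneg_of_mul_nonneg_right e5 (by positivity)
    linarith
  have : (d : ℝ) + 1 - 2 = d - 1 := by ring
  rw [this]
  linarith

theorem pendentGain_anti {d e : ℕ} (hd : 2 ≤ d) (hde : d ≤ e) :
    pendentGain e ≤ pendentGain d := by
  induction e, hde using Nat.le_induction with
  | base => exact le_rfl
  | succ e he ih => exact (pendentGain_succ_le (by omega)).trans ih

theorem pendentGain_three : pendentGain 3 = invSqrt 5 - (invSqrt 3 - 1 / 2) := by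
  unfold pendentGain
  norm_num [invSqrt_four]

theorem pendentGain_four : pendentGain 4 = invSqrt 6 - 2 * (1 / 2 - invSqrt 5) := by
  unfold pendentGain
  norm_num [invSqrt_four]

theorem pendentGain_six : pendentGain 6 = invSqrt 8 - 4 * (invSqrt 6 - invSqrt 7) := by
  unfold pendentGain
  norm_num

theorem sumConnectivity_graphB_three {n : ℕ} (hn : 4 ≤ n) :
    sumConnectivity (graphB (n - 1) 3) = invSqrt (n + 2) + ((n : ℝ) - 4) * invSqrt n
      + 2 * invSqrt (n + 1) + 2 * invSqrt 5 := by
  rw [sumConnectivity_graphB (by omega) le_rfl]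
  obtain ⟨m, rfl⟩ := Nat.exists_eq_add_of_le' (show 1 ≤ n by omega)
  simp only [Nat.add_sub_cancel, add_assoc]
  norm_num
  ring

theorem sumConnectivity_graphB_four {n : ℕ} (hn : 5 ≤ n) :
    sumConnectivity (graphB (n - 2) 4) = invSqrt (n + 2) + 2 * invSqrt n
      + ((n : ℝ) - 5) * invSqrt (n - 1) + 2 * invSqrt 6 + invSqrt 5 := by
  rw [sumConnectivity_graphB (by omega) (by norm_num)]
  obtain ⟨m, rfl⟩ := Nat.exists_eq_add_of_le' (show 2 ≤ n by omega)
  simp only [Nat.add_sub_cancel, add_assoc]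
  norm_num
  ring

/-! ### Comparing the extremal values -/

/-- The second smallest value of the sum-connectivity index on the bicyclic graphs with `n`
vertices. -/
def secondValue (n : ℕ) : ℝ :=
  if n = 5 then sumConnectivity graphFive
  else if n ≤ 7 then sumConnectivity (graphB (n - 2) 4)
  else sumConnectivity (graphBThree n)

theorem secondValue_five : secondValue 5 = sumConnectivity graphFive := rfl

theorem secondValue_of_le_seven {n : ℕ} (h6 : 6 ≤ n) (h7 : n ≤ 7) :
    secondValue n = sumConnectivity (graphB (n - 2) 4) := by
  rw [secondValue, if_neg (by omega), if_pos h7]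

theorem secondValue_of_eight_le {n : ℕ} (hn : 8 ≤ n) :
    secondValue n = sumConnectivity (graphBThree n) := by
  rw [secondValue, if_neg (by omega), if_neg (by omega)]

theorem secondValue_six_eq : secondValue 6 = invSqrt 8 + 4 * invSqrt 6 + 2 * invSqrt 5 := by
  rw [secondValue_of_le_seven (by norm_num) (by norm_num),
    sumConnectivity_graphB_four (by norm_num)]
  norm_num
  ring

theorem secondValue_seven_eq :
    secondValue 7 = invSqrt 9 + 2 * invSqrt 7 + 4 * invSqrt 6 + invSqrt 5 := by
  rw [secondValue_of_le_seven (by norm_num) (by norm_num),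
    sumConnectivity_graphB_four (by norm_num)]
  norm_num
  ring

/-- The tangent at n bounds later values from below; here and in the next two lemmas, neighbouring
values become rational multiples of one another, so later estimates have a single unknown. -/
theorem mul_invSqrt_le_succ {n : ℕ} (hn : 0 < n) :
    (2 * (n : ℝ) - 1) * invSqrt n ≤ 2 * n * invSqrt (n + 1) := by
  have h := invSqrt_tangent_le hn n.succ_pos
  have hn' : (0 : ℝ) < n := by exact_mod_cast hn
  rw [div_le_iff₀ (by positivity)] at h
  push_cast at h
  linarith

theorem mul_invSqrt_le_add_two {n : ℕ} (hn : 0 < n) :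
    (2 * (n : ℝ) - 2) * invSqrt n ≤ 2 * n * invSqrt (n + 2) := by
  have h := invSqrt_tangent_le hn (x := n + 2) (by omega)
  have hn' : (0 : ℝ) < n := by exact_mod_cast hn
  rw [div_le_iff₀ (by positivity)] at h
  push_cast at h
  linarith

/-- The tangent is taken at n + 1 and evaluated at n, which turns the bound into an upper one for
the later value. -/
theorem mul_invSqrt_succ_le {n : ℕ} (hn : 0 < n) :
    (2 * (n : ℝ) + 3) * invSqrt (n + 1) ≤ (2 * n + 2) * invSqrt n := by
  have h := invSqrt_tangent_le n.succ_pos hn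
  rw [div_le_iff₀ (by positivity)] at h
  push_cast at h
  linarith

theorem sumConnectivity_graphB_three_lt_graphBThree {n : ℕ} (hn : 5 ≤ n) :
    sumConnectivity (graphB (n - 1) 3) < sumConnectivity (graphBThree n) := by
  rw [sumConnectivity_graphB_three (by omega), sumConnectivity_graphBThree hn]
  have h1 := mul_invSqrt_le_succ (n := n) (by omega)
  have h2 : invSqrt (n + 2) ≤ invSqrt (n + 1) := invSqrt_anti (by omega) (by omega)
  have h3 : invSqrt n ≤ invSqrt 5 := invSqrt_anti (by omega) hn
  have h4 := invSqrt_five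
  have hn' : (5 : ℝ) ≤ n := by exact_mod_cast hn
  -- The difference is at most 1/(2n√n) < 0.045; the conclusion tolerates anything below 1 - 2/√5 ≈
  -- 0.1056.
  have h5 : invSqrt n - invSqrt (n + 1) ≤ 0.05 := by
    by_contra! h
    nlinarith
  linarith

theorem secondValue_lt_graphB_four {n : ℕ} (hn : 8 ≤ n) :
    secondValue n < sumConnectivity (graphB (n - 2) 4) := by
  rw [secondValue_of_eight_le hn, sumConnectivity_graphB_four (by omega),
    sumConnectivity_graphBThree (by omega)]
  have h1 := mul_invSqrt_succ_le (n := n) (by omega)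
  have h2 := mul_invSqrt_le_add_two (n := n) (by omega)
  have h3 := mul_invSqrt_succ_le (n := n - 1) (by omega)
  rw [Nat.sub_add_cancel (by omega), Nat.cast_sub (by omega), Nat.cast_one] at h3
  have h4 : invSqrt n ≤ invSqrt 8 := invSqrt_anti (by omega) hn
  have h5 := invSqrt_five
  have h6 := invSqrt_six
  have h8 := invSqrt_eight
  have hN : (8 : ℝ) ≤ n := by exact_mod_cast hn
  generalize (n : ℝ) = N at *
  generalize invSqrt n = a at *
  generalize invSqrt (n + 1) = b at *
  generalize invSqrt (n + 2) = c at *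
  generalize invSqrt (n - 1) = z at *
  have e1 := mul_le_mul_of_nonneg_left h1 (show 0 ≤ 2 * N by linarith)
  have e2 := mul_le_mul_of_nonneg_left h2 (show 0 ≤ 2 * N + 3 by linarith)
  have e3 := mul_le_mul_of_nonneg_left h3 (show 0 ≤ (2 * N + 3) * (N - 5) by
    apply mul_nonneg <;> linarith)
  have e4 : a * (2 * N ^ 2 + 9 * N + 21) ≤ 0.353554 * (2 * N ^ 2 + 9 * N + 21) :=
    mul_le_mul_of_nonneg_right (by linarith) (by positivity)
  -- 0.2637 is a lower bound for 2/√6 + 1/√5 - 1. Replacing b, c and z by multiples of a leaves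
  -- -(2N² + 9N + 21)a, and a ≤ 1/√8.
  have e5 : 0 < 2 * N * (2 * N + 3) * (c - 4 * b + 2 * a + (N - 5) * (z - a) + 0.2637) := by
    nlinarith
  have e6 := pos_of_mul_pos_right e5 (by positivity)
  linarith

theorem secondValue_lt_add_pendentGain_three {n : ℕ} (hn : 6 ≤ n) :
    secondValue n < sumConnectivity (graphB (n - 2) 3) + pendentGain 3 := by
  rw [show n - 2 = (n - 1) - 1 by omega, sumConnectivity_graphB_three (by omega),
    pendentGain_three]
  have := invSqrt_three
  have h5 := invSqrt_five
  have := invSqrt_six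
  have := invSqrt_seven
  have h8 := invSqrt_eight
  have := invSqrt_nine
  rcases lt_or_ge n 8 with h | h
  · interval_cases n
    · rw [secondValue_six_eq]
      norm_num
      linarith
    · rw [secondValue_seven_eq]
      norm_num
      linarith
  rw [secondValue_of_eight_le h, sumConnectivity_graphBThree (by omega)]
  have h1 := mul_invSqrt_succ_le (n := n) (by omega)
  have h3 := mul_invSqrt_succ_le (n := n - 1) (by omega)
  have h4 : invSqrt n ≤ invSqrt 8 := invSqrt_anti (by omega) h
  rw [show n - 1 + 2 = n + 1 by omega, Nat.sub_add_cancel (by omega), Nat.cast_sub (by omega),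
    Nat.cast_one] at *
  have hN : (8 : ℝ) ≤ n := by exact_mod_cast h
  generalize (n : ℝ) = N at *
  generalize invSqrt n = a at *
  generalize invSqrt (n + 1) = b at *
  generalize invSqrt (n - 1) = z at *
  have e1 := mul_le_mul_of_nonneg_left h1 (show 0 ≤ 2 * N by linarith)
  have e3 := mul_le_mul_of_nonneg_left h3 (show 0 ≤ (2 * N + 3) * (N - 5) by
    apply mul_nonneg <;> linarith)
  have e4 : a * (2 * N ^ 2 + 7 * N + 15) ≤ 0.353554 * (2 * N ^ 2 + 7 * N + 15) :=
    mul_le_mul_of_nonneg_right (by linarith) (by positivity)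
  -- Here 0.264 is a lower bound for 3/√5 - 1/√3 - 1/2.
  have e5 : 0 < 2 * N * (2 * N + 3) * (0.264 - (3 * b - 2 * a - (N - 5) * (z - a))) := by
    nlinarith
  have e6 := pos_of_mul_pos_right e5 (by positivity)
  linarith

/-- By antitonicity only the largest admissible d matters. For n = 7 and d = 5 the inequality is
false, hence `h7`. -/
theorem secondValue_lt_add_pendentGain {n d : ℕ} (hn : 6 ≤ n) (hd : 2 ≤ d) (hdn : d + 2 ≤ n)
    (h7 : n = 7 → d ≤ 4) : secondValue n < secondValue (n - 1) + pendentGain d := by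
  have := invSqrt_five
  have := invSqrt_six
  have := invSqrt_seven
  have := invSqrt_eight
  have := invSqrt_nine
  rcases lt_or_ge n 8 with h | h
  · have hg : pendentGain 4 ≤ pendentGain d := pendentGain_anti hd (by omega)
    rw [pendentGain_four] at hg
    interval_cases n
    · rw [secondValue_six_eq, show 6 - 1 = 5 by norm_num, secondValue_five,
        sumConnectivity_graphFive]
      linarith
    · rw [secondValue_seven_eq, show 7 - 1 = 6 by norm_num, secondValue_six_eq]
      linarith
  have hg : pendentGain (n - 2) ≤ pendentGain d := pendentGain_anti hd (by omega)
  rw [secondValue_of_eight_le h, sumConnectivity_graphBThree (by omega)]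
  rcases h.eq_or_lt with rfl | h9
  · rw [show 8 - 1 = 7 by norm_num, secondValue_seven_eq]
    rw [show 8 - 2 = 6 by norm_num, pendentGain_six] at hg
    norm_num
    linarith
  rw [secondValue_of_eight_le (by omega), sumConnectivity_graphBThree (by omega)]
  obtain ⟨m, rfl⟩ := Nat.exists_eq_add_of_le' (show 2 ≤ n by omega)
  have hm2 : pendentGain (m + 2 - 2)
      = invSqrt (m + 2) - ((m : ℝ) - 2) * (invSqrt m - invSqrt (m + 1)) := rfl
  simp only [show m + 2 - 1 = m + 1 by omega, add_assoc]
  norm_num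
  have h1 := mul_invSqrt_sub_succ_le (m := m) (by omega)
  have h2 := mul_invSqrt_sub_succ_le (m := m + 1) (by omega)
  have hx : 0 < invSqrt m - invSqrt (m + 1) := by
    rw [invSqrt_sub_succ (by omega)]
    have : (0 : ℝ) < m := by exact_mod_cast (show 0 < m by omega)
    positivity
  simp only [add_assoc] at h2
  norm_num at h2
  have hm : (7 : ℝ) ≤ m := by exact_mod_cast (show 7 ≤ m by omega)
  -- With m = n - 2 = d, this is the goal rewritten in consecutive differences; the elimination is
  -- the one used for `pendentGain_succ_le`.
  have key : ((m : ℝ) - 2) * (invSqrt m - invSqrt (m + 1))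
      < (m - 4) * (invSqrt (m + 1) - invSqrt (m + 2))
        + 4 * (invSqrt (m + 2) - invSqrt (m + 3)) := by
    generalize invSqrt m - invSqrt (m + 1) = x at *
    generalize invSqrt (m + 1) - invSqrt (m + 2) = y at *
    generalize invSqrt (m + 2) - invSqrt (m + 3) = z at *
    have e1 : 0 < (2 * (m : ℝ) + 5) * ((2 * m + 3) * ((m - 4) * y + 4 * z - (m - 2) * x)) := by
      have e2 : 0 < (2 * (m : ℝ) ^ 2 - 7 * m + 30) * x := mul_pos (by nlinarith) hx
      have e3 : 0 ≤ (2 * (m : ℝ) ^ 2 + 5 * m - 12) * ((2 * m + 3) * y - 2 * m * x) :=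
        mul_nonneg (by nlinarith) (by linarith)
      have e4 : 0 ≤ 4 * (2 * (m : ℝ) + 3) * ((2 * m + 5) * z - (2 * m + 2) * y) :=
        mul_nonneg (by positivity) (by linarith)
      nlinarith
    have e5 := pos_of_mul_pos_right e1 (by positivity)
    have e6 := pos_of_mul_pos_right e5 (by positivity)
    linarith
  linarith

theorem secondValue_lt_half {n : ℕ} (hn : 6 ≤ n) : secondValue n < n / 2 := by
  have := invSqrt_five
  have := invSqrt_six
  have := invSqrt_seven
  have h8 := invSqrt_eight
  have h9 := invSqrt_nine
  rcases lt_or_ge n 8 with h | h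
  · interval_cases n
    · rw [secondValue_six_eq]
      norm_num
      linarith
    · rw [secondValue_seven_eq]
      norm_num
      linarith
  rw [secondValue_of_eight_le h, sumConnectivity_graphBThree (by omega)]
  have h1 : invSqrt n ≤ invSqrt 8 := invSqrt_anti (by omega) h
  have h2 : invSqrt (n + 1) ≤ invSqrt 9 := invSqrt_anti (by omega) (by omega)
  have hN : (8 : ℝ) ≤ n := by exact_mod_cast h
  have h3 : ((n : ℝ) - 5) * invSqrt n ≤ (n - 5) * 0.4 :=
    mul_le_mul_of_nonneg_left (by linarith) (by linarith)
  linarith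

theorem graphB_three_lt_secondValue {n : ℕ} (hn : 5 ≤ n) :
    sumConnectivity (graphB (n - 1) 3) < secondValue n := by
  rcases lt_or_ge n 8 with h | h
  · have := invSqrt_five
    have := invSqrt_six
    have := invSqrt_seven
    have := invSqrt_eight
    have := invSqrt_nine
    rw [sumConnectivity_graphB_three (by omega)]
    interval_cases n
    · rw [secondValue_five, sumConnectivity_graphFive]
      norm_num
      linarith
    · rw [secondValue_six_eq]
      norm_num
      linarith
    · rw [secondValue_seven_eq]
      norm_num
      linarith
  · rw [secondValue_of_eight_le h]
    exact sumConnectivity_graphB_three_lt_graphBThree hn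

theorem secondValue_lt_graphBThree {n : ℕ} (h5 : 5 ≤ n) (h7 : n ≤ 7) :
    secondValue n < sumConnectivity (graphBThree n) := by
  rw [sumConnectivity_graphBThree h5]
  have := invSqrt_five
  have := invSqrt_six
  have := invSqrt_seven
  have := invSqrt_eight
  have := invSqrt_nine
  interval_cases n
  · rw [secondValue_five, sumConnectivity_graphFive]
    norm_num
    linarith
  · rw [secondValue_six_eq]
    norm_num
    linarith
  · rw [secondValue_seven_eq]
    norm_num
    linarith

/-! ### Identifying a graph from the result of deleting a pendent vertex -/

theorem degree_pos_of_mem_bicyclicGraphs {V : Type*} [Fintype V] {G : SimpleGraph V}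
    (hG : G ∈ bicyclicGraphs V) (v : V) : 0 < G.degree v := by
  obtain ⟨w, hw, -⟩ := exists_adj_two_le_degree hG v
  exact (G.degree_pos_iff_exists_adj v).2 ⟨w, hw⟩

theorem iso_graphB_or_graphBThree {W : Type*} [Fintype W] {H : SimpleGraph W}
    (hH : H ∈ bicyclicGraphs W) {c : W} (hc : H.degree c + 1 = Fintype.card W) :
    Nonempty (H ≃g graphB (Fintype.card W - 1) 3) ∨
      (5 ≤ Fintype.card W ∧ Nonempty (H ≃g graphBThree (Fintype.card W))) := by
  rcases iso_of_degree_add_one_eq_card hH hc with ⟨h4, φ, -⟩ | ⟨h5, φ, -⟩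
  · left
    have hemp : IsEmpty (Fin (3 - 3)) := Fin.isEmpty'
    have hk : Fintype.card W - 4 = Fintype.card W - 1 - 3 := by omega
    exact ⟨φ.trans (attachPendentsCongr Iso.refl
      ((finCongr hk).trans (Equiv.sumEmpty _ (Fin (3 - 3))).symm) fun p => rfl)⟩
  · exact Or.inr ⟨h5, ⟨φ⟩⟩

/-- Attaching a pendent vertex to a vertex of degree at least three, other than the one adjacent to
all others. -/
theorem iso_graphB_of_three_le_degree {W : Type*} [Fintype W] {H : SimpleGraph W}
    (hH : H ∈ bicyclicGraphs W) {c v : W} (hc : H.degree c + 1 = Fintype.card W) (hv : v ≠ c)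
    (h3 : 3 ≤ H.degree v) :
    Nonempty (attachPendents H (fun _ : Unit => v) ≃g graphB (Fintype.card W - 1) 4) := by
  rcases iso_of_degree_add_one_eq_card hH hc with ⟨h4, φ, hφ⟩ | ⟨h5, φ, hφ⟩
  · have hv1 : φ v = Sum.inl 1 := by
      have hne : φ v ≠ Sum.inl 0 := fun h => hv (φ.injective (h.trans hφ.symm))
      rw [← φ.degree_eq v] at h3
      rcases hi : φ v with i | p
      · rw [hi, attachPendents_degree_inl, degree_diamond] at h3
        rw [hi] at hne
        fin_cases i <;> simp at h3 hne ⊢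
      · rw [hi, attachPendents_degree_inr] at h3
        omega
    have hk : Fintype.card W - 4 = Fintype.card W - 1 - 3 := by omega
    refine ⟨(attachPendentsCongr (f' := fun _ : Unit => Sum.inl 1) φ (Equiv.refl _)
      fun _ => hv1.symm).trans ((attachPendentsAttach _ _ fun _ => 1).trans
        (attachPendentsCongr Iso.refl
          (Equiv.sumCongr (finCongr hk)
            (show Unit ≃ Fin (4 - 3) from Equiv.ofUnique Unit (Fin 1))) ?_))⟩
    rintro (p | p) <;> rfl
  · exfalso
    have hne : φ v ≠ Sum.inl 0 := fun h => hv (φ.injective (h.trans hφ.symm))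
    rw [← φ.degree_eq v] at h3
    rcases hi : φ v with i | p
    · rw [hi, attachPendents_degree_inl, degree_bowtie] at h3
      rw [hi] at hne
      fin_cases i <;> simp at h3 hne
    · rw [hi, attachPendents_degree_inr] at h3
      omega

/-- By this symmetry it does not matter which vertex of degree two receives the pendent vertex. -/
theorem diamond_adj_swap : ∃ σ : diamond ≃g diamond, σ 3 = 2 := by
  refine ⟨⟨Equiv.swap 2 3, ?_⟩, Equiv.swap_apply_right 2 3⟩
  intro a b
  fin_cases a <;> fin_cases b <;> simp [diamond, Equiv.swap_apply_def]

theorem iso_graphFive {W : Type*} [Fintype W] {H : SimpleGraph W} (hH : H ∈ bicyclicGraphs W)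
    (hW : Fintype.card W = 4) {v : W} (hv : H.degree v ≤ 2) :
    Nonempty (attachPendents H (fun _ : Unit => v) ≃g graphFive) := by
  -- Five edges give degree sum 10, more than four vertices of degree at most 2 allow.
  obtain ⟨c, hc⟩ : ∃ c, H.degree c + 1 = Fintype.card W := by
    by_contra! hcon
    have h1 := sum_degree_of_mem_bicyclicGraphs hH
    have h2 : ∑ w, H.degree w ≤ _ := Finset.sum_le_card_nsmul Finset.univ _ 2 fun w _ => by
      have := H.degree_lt_card_verts w
      have := hcon w
      omega
    rw [Finset.card_univ, hW, smul_eq_mul] at h2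
    omega
  rcases iso_of_degree_add_one_eq_card hH hc with ⟨h4, φ, hφ⟩ | ⟨h5, -⟩
  · have hemp : IsEmpty (Fin (Fintype.card W - 4)) := by
      rw [hW]
      exact Fin.isEmpty'
    obtain ⟨ψ⟩ : Nonempty (attachPendents diamond (fun _ : Fin (Fintype.card W - 4) => 0)
        ≃g diamond) := by
      refine ⟨⟨Equiv.sumEmpty _ _, ?_⟩⟩
      rintro (a | p) (b | q)
      · rfl
      · exact hemp.elim q
      · exact hemp.elim p
      · exact hemp.elim p
    obtain ⟨χ, hχ⟩ : ∃ χ : H ≃g diamond, χ v = 2 := by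
      let χ : H ≃g diamond := φ.trans ψ
      have h6 := χ.degree_eq v
      rw [degree_diamond] at h6
      obtain ⟨σ, hσ⟩ := diamond_adj_swap
      rcases hi : χ v with ⟨i, hi4⟩
      rw [hi] at h6
      interval_cases i
      · simp at h6; omega
      · simp at h6; omega
      · exact ⟨_, hi⟩
      · refine ⟨χ.trans σ, ?_⟩
        rw [← hσ]
        exact congrArg σ hi
    exact ⟨attachPendentsCongr χ (Equiv.ofUnique Unit (Fin 1)) fun _ => hχ.symm⟩
  · omega

theorem mem_bicyclicGraphs_of_attachPendents {V W : Type*} [Fintype V] [Fintype W]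
    {G : SimpleGraph V} {H : SimpleGraph W} {v : W} (hG : G ∈ bicyclicGraphs V)
    (hH : H.Connected) (e : attachPendents H (fun _ : Unit => v) ≃g G) :
    H ∈ bicyclicGraphs W := by
  refine ⟨hH, ?_⟩
  have h1 := card_edgeFinset_attachPendents H (fun _ : Unit => v)
  have h2 := e.card_edgeFinset_eq
  have h3 : G.edgeFinset.card = Fintype.card V + 1 := hG.2
  have h4 := Fintype.card_congr e.toEquiv
  rw [Fintype.card_sum, Fintype.card_unit] at h4
  rw [Fintype.card_unit] at h1
  omega

theorem degree_of_iso_attachPendents {V W : Type*} [Fintype V] [Fintype W]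
    {G : SimpleGraph V} {H : SimpleGraph W} {v : W}
    (e : attachPendents H (fun _ : Unit => v) ≃g G) :
    G.degree (e (Sum.inl v)) = H.degree v + 1 := by
  rw [e.degree_eq, attachPendents_degree_inl]
  simp

theorem degree_le_of_iso_attachPendents {V W P : Type*} [Fintype V] [Fintype W] [Fintype P]
    {G : SimpleGraph V} {H : SimpleGraph W} {f : P → W} (e : attachPendents H f ≃g G) (w : W) :
    H.degree w ≤ G.degree (e (Sum.inl w)) := by
  rw [e.degree_eq, attachPendents_degree_inl]
  exact Nat.le_add_right _ _

/-- A bicyclic graph with a pendent vertex arises from a smaller one by attaching it. -/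
theorem exists_iso_attachPendents_of_degree_eq_one.{u} {V : Type u} [Fintype V] {G : SimpleGraph V}
    (hG : G ∈ bicyclicGraphs V) {u v : V} (huv : G.Adj u v) (hu : G.degree u = 1) :
    ∃ (W : Type u) (_ : Fintype W) (H : SimpleGraph W) (w : W)
      (e : attachPendents H (fun _ : Unit => w) ≃g G),
      H ∈ bicyclicGraphs W ∧ e (Sum.inl w) = v := by
  have hu' : ∀ w, G.Adj u w → w = v := by
    intro w hw
    obtain ⟨x, hx⟩ := Finset.card_eq_one.1 ((G.card_neighborFinset_eq_degree u).trans hu)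
    have h1 : w ∈ G.neighborFinset u := by simpa using hw
    have h2 : v ∈ G.neighborFinset u := by simpa using huv
    rw [hx, Finset.mem_singleton] at h1 h2
    rw [h1, h2]
  obtain ⟨e, he⟩ := exists_iso_attachPendents_induce G huv hu'
  exact ⟨_, inferInstance, _, _, e, mem_bicyclicGraphs_of_attachPendents hG
    (hG.1.induce_compl_singleton_of_degree_eq_one hu) e, he⟩

/-! ### The exceptional case n = 7, d = 5 -/

/-- Five edges meet `v`, three avoid it, and a single vertex `w` is not adjacent to `v`. Bounding
the two groups of edges separately gives at least 5/√7 + 2/√5 + 1/√6. -/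
theorem secondValue_seven_lt {V : Type*} [Fintype V] {G : SimpleGraph V}
    (hG : G ∈ bicyclicGraphs V) (hV : Fintype.card V = 7) {v : V} (hv : G.degree v = 5)
    (hpend : ∀ u w, G.Adj u w → G.degree u = 1 → 5 ≤ G.degree w) :
    secondValue 7 < sumConnectivity G := by
  set R := G.edgeFinset.filter (v ∉ ·) with hR
  have hRcard : R.card = 3 := by
    have h1 := card_edgeFinset_eq_add G v
    have h2 : G.edgeFinset.card = Fintype.card V + 1 := hG.2
    rw [← hR] at h1
    omega
  have hdeg : ∀ z, z ≠ v →
      G.degree z = (R.filter (z ∈ ·)).card + if G.Adj v z then 1 else 0 := by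
    intro z hz
    rw [← card_incidenceFinset_eq_degree, incidenceFinset_eq_filter,
      ← Finset.card_filter_add_card_filter_not (s := G.edgeFinset.filter (z ∈ ·)) (v ∉ ·)]
    congr 1
    · rw [hR, Finset.filter_filter, Finset.filter_filter]
      simp only [and_comm]
    · have : (G.edgeFinset.filter (z ∈ ·)).filter (fun e => ¬ v ∉ e)
          = if G.Adj v z then {s(v, z)} else ∅ := by
        ext e
        simp only [not_not, Finset.mem_filter, mem_edgeFinset]
        constructor
        · rintro ⟨⟨h1, h2⟩, h3⟩
          have h4 := (Sym2.mem_and_mem_iff hz.symm).1 ⟨h3, h2⟩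
          rw [h4, mem_edgeSet] at h1
          simp [h1, h4]
        · split_ifs with h
          · intro h1
            rw [Finset.mem_singleton.1 h1]
            simpa using h
          · simp
      rw [this]
      split_ifs <;> simp
  obtain ⟨w, hwv, hw⟩ : ∃ w, w ≠ v ∧ ¬ G.Adj v w := by
    by_contra! hcon
    have : Finset.univ.erase v ⊆ G.neighborFinset v := by
      intro x hx
      simpa using hcon x (Finset.ne_of_mem_erase hx)
    have := Finset.card_le_card this
    rw [Finset.card_erase_of_mem (Finset.mem_univ v), Finset.card_univ,
      card_neighborFinset_eq_degree] at this
    omega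
  have hN : G.neighborFinset v = (Finset.univ.erase v).erase w := by
    refine Finset.eq_of_subset_of_card_le ?_ ?_
    · intro x hx
      have hx : G.Adj v x := by simpa using hx
      simp only [Finset.mem_erase, Finset.mem_univ, and_true]
      exact ⟨fun h => hw (h ▸ hx), hx.ne'⟩
    · rw [Finset.card_erase_of_mem (by simpa using hwv),
        Finset.card_erase_of_mem (Finset.mem_univ v), Finset.card_univ,
        card_neighborFinset_eq_degree]
      omega
  -- A pendent `w` would need a neighbour of degree at least 5, but a vertex other than `v` has
  -- degree at most 3 + 1.
  have hw2 : 2 ≤ G.degree w := by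
    by_contra! h
    have h0 := degree_pos_of_mem_bicyclicGraphs hG w
    obtain ⟨z, hz⟩ := (G.degree_pos_iff_exists_adj w).1 h0
    have h1 := hpend w z hz (by omega)
    have h2 := hdeg z (fun h => hw (h ▸ hz.symm))
    have h3 := Finset.card_filter_le R (z ∈ ·)
    split_ifs at h2 <;> omega
  have hwR : G.degree w = (R.filter (w ∈ ·)).card := by
    simpa [hw] using hdeg w hwv
  have hsum : ∑ x ∈ G.neighborFinset v, G.degree x ≤ 9 := by
    have h1 := sum_degree_of_mem_bicyclicGraphs hG
    rw [← Finset.add_sum_erase _ _ (Finset.mem_univ v),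
      ← Finset.add_sum_erase (Finset.univ.erase v) _ (show w ∈ Finset.univ.erase v by simpa using hwv),
      ← hN] at h1
    omega
  have hfirst : 5 * invSqrt 7 ≤ ∑ x ∈ G.neighborFinset v,
      weight (fun x => G.degree x) s(v, x) := by
    have h1 : ∀ x ∈ G.neighborFinset v,
        invSqrt 7 / 14 * (16 - (G.degree x : ℝ)) ≤ weight (fun x => G.degree x) s(v, x) := by
      intro x _
      rw [weight_mk, hv]
      refine le_trans (le_of_eq ?_) (invSqrt_tangent_le (a := 7) (by norm_num) (by omega))
      push_cast
      ring
    refine le_trans ?_ (Finset.sum_le_sum h1)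
    rw [← Finset.mul_sum, Finset.sum_sub_distrib, Finset.sum_const,
      card_neighborFinset_eq_degree, hv]
    have h2 : (∑ x ∈ G.neighborFinset v, (G.degree x : ℝ)) ≤ 9 := by exact_mod_cast hsum
    have h3 := invSqrt_seven
    simp only [nsmul_eq_mul]
    push_cast
    nlinarith
  -- Among three edges, only ab itself contains both a and b, so their incidences total at most 3 +
  -- 1. Each endpoint gains at most one more edge, to `v`, and `w` gains none: hence degree sums 6
  -- and 5.
  have hpair : ∀ a b, s(a, b) ∈ R →
      a ≠ v ∧ b ≠ v ∧ (R.filter (a ∈ ·)).card + (R.filter (b ∈ ·)).card ≤ 4 := by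
    intro a b hab
    have h1 := (Finset.mem_filter.1 hab).1
    have h2 := (Finset.mem_filter.1 hab).2
    simp only [Sym2.mem_iff, not_or] at h2
    have hne : a ≠ b := (show G.Adj a b by simpa using h1).ne
    refine ⟨Ne.symm h2.1, Ne.symm h2.2, ?_⟩
    rw [← Finset.card_union_add_card_inter]
    have h3 : (R.filter (a ∈ ·)) ∪ (R.filter (b ∈ ·)) ⊆ R :=
      Finset.union_subset (Finset.filter_subset _ _) (Finset.filter_subset _ _)
    have h4 : (R.filter (a ∈ ·)) ∩ (R.filter (b ∈ ·)) ⊆ {s(a, b)} := by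
      intro e he
      simp only [Finset.mem_inter, Finset.mem_filter] at he
      rw [Finset.mem_singleton]
      exact (Sym2.mem_and_mem_iff hne).1 ⟨he.1.2, he.2.2⟩
    have h5 := Finset.card_le_card h3
    have h6 := Finset.card_le_card h4
    rw [Finset.card_singleton] at h6
    omega
  have hsix : ∀ e ∈ R.filter (w ∉ ·), invSqrt 6 ≤ weight (fun x => G.degree x) e := by
    intro e he
    have he := (Finset.mem_filter.1 he).1
    induction e with
    | h a b =>
      obtain ⟨ha, hb, hab⟩ := hpair a b he
      have h1 := hdeg a ha
      have h2 := hdeg b hb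
      have h3 := degree_pos_of_mem_bicyclicGraphs hG a
      rw [weight_mk]
      refine invSqrt_anti (by omega) ?_
      split_ifs at h1 h2 <;> omega
  have hfive : ∀ e ∈ R.filter (w ∈ ·), invSqrt 5 ≤ weight (fun x => G.degree x) e := by
    intro e he
    have hwe := (Finset.mem_filter.1 he).2
    have he := (Finset.mem_filter.1 he).1
    obtain ⟨b, rfl⟩ := Sym2.mem_iff_exists.1 hwe
    obtain ⟨-, hb, hab⟩ := hpair w b he
    have h2 := hdeg b hb
    rw [weight_mk]
    refine invSqrt_anti (by omega) ?_
    split_ifs at h2 <;> omega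
  have hsecond : 2 * invSqrt 5 + invSqrt 6 ≤ ∑ e ∈ R, weight (fun x => G.degree x) e := by
    rw [← Finset.sum_filter_add_sum_filter_not R (w ∈ ·)]
    have h1 := Finset.card_nsmul_le_sum _ _ _ hfive
    have h2 := Finset.card_nsmul_le_sum _ _ _ hsix
    have h3 := Finset.card_filter_add_card_filter_not (s := R) (w ∈ ·)
    have h4 := invSqrt_five
    have h5 := invSqrt_six
    rw [nsmul_eq_mul] at h1 h2
    rw [hRcard] at h3
    have h6 : ((R.filter (w ∈ ·)).card : ℝ) + ((R.filter (w ∉ ·)).card : ℝ) = 3 := by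
      exact_mod_cast h3
    have h7 : (2 : ℝ) ≤ ((R.filter (w ∈ ·)).card : ℝ) := by
      rw [← hwR]
      exact_mod_cast hw2
    nlinarith
  rw [secondValue_seven_eq, sumConnectivity_eq, sum_edgeFinset_eq_add G v]
  have := invSqrt_five
  have := invSqrt_six
  have := invSqrt_seven
  have := invSqrt_nine
  linarith

/-! ### The induction on the number of vertices -/

theorem le_sumConnectivity_of_degree_add_one_eq_card {W : Type*} [Fintype W] {H : SimpleGraph W}
    (hH : H ∈ bicyclicGraphs W) {c : W} (hc : H.degree c + 1 = Fintype.card W) :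
    sumConnectivity (graphB (Fintype.card W - 1) 3) ≤ sumConnectivity H := by
  rcases iso_graphB_or_graphBThree hH hc with ⟨⟨e⟩⟩ | ⟨h5, ⟨e⟩⟩
  · exact (sumConnectivity_congr e).ge
  · rw [sumConnectivity_congr e]
    exact (sumConnectivity_graphB_three_lt_graphBThree h5).le

/-- The graphs attaining `secondValue n` among those without a vertex adjacent to all others. -/
def IsSecondMinimizer {V : Type*} (n : ℕ) (G : SimpleGraph V) : Prop :=
  (n = 5 ∧ Nonempty (G ≃g graphFive)) ∨ ((n = 6 ∨ n = 7) ∧ Nonempty (G ≃g graphB (n - 2) 4))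

theorem IsSecondMinimizer.sumConnectivity_eq {V : Type*} [Fintype V] {n : ℕ} {G : SimpleGraph V}
    (h : IsSecondMinimizer n G) : sumConnectivity G = secondValue n := by
  rcases h with ⟨rfl, ⟨e⟩⟩ | ⟨h, ⟨e⟩⟩
  · exact (sumConnectivity_congr e).trans secondValue_five.symm
  · rw [secondValue_of_le_seven (by omega) (by omega)]
    exact sumConnectivity_congr e

/-- The vertex type is quantified after n because the induction hypothesis is applied to a graph on
a different type. -/
theorem isSecondMinimizer_or_secondValue_lt.{u} {n : ℕ} (hn : 5 ≤ n) :
    ∀ {V : Type u} [Fintype V] {G : SimpleGraph V}, Fintype.card V = n → G ∈ bicyclicGraphs V →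
      (∀ v, G.degree v + 2 ≤ n) → IsSecondMinimizer n G ∨ secondValue n < sumConnectivity G := by
  induction n, hn using Nat.le_induction with
  | base =>
    intro V _ G hV hG hdeg
    by_cases hp : ∃ u, G.degree u = 1
    · left
      obtain ⟨u, hu⟩ := hp
      obtain ⟨v, huv⟩ := (G.degree_pos_iff_exists_adj u).1 (by omega)
      obtain ⟨W, _, H, w, e, hH, rfl⟩ := exists_iso_attachPendents_of_degree_eq_one hG huv hu
      have h1 := hdeg (e (Sum.inl w))
      rw [degree_of_iso_attachPendents e] at h1
      have h2 := Fintype.card_congr e.toEquiv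
      rw [Fintype.card_sum, Fintype.card_unit] at h2
      obtain ⟨e'⟩ := iso_graphFive hH (by omega) (show H.degree w ≤ 2 by omega)
      exact Or.inl ⟨rfl, ⟨e.symm.trans e'⟩⟩
    · right
      push Not at hp
      -- The degree bound 3 gives 2.625, just above the required 2.6192; the general bound 4 would
      -- give only 2.5.
      have h1 := le_sumConnectivity_of_two_le_degree hG (k := 1) (fun v => by
        have := hp v
        have := degree_pos_of_mem_bicyclicGraphs hG v
        omega) (fun v => by
        have := hdeg v
        omega)
      rw [hV] at h1
      rw [secondValue_five, sumConnectivity_graphFive]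
      have := invSqrt_five
      have := invSqrt_six
      norm_num at h1
      linarith
  | succ n hn ih =>
    intro V _ G hV hG hdeg
    by_cases hp : ∃ u, G.degree u = 1
    · by_cases h7 : n + 1 = 7 ∧ ∀ u w, G.Adj u w → G.degree u = 1 → 5 ≤ G.degree w
      · right
        obtain ⟨u, hu⟩ := hp
        obtain ⟨v, huv⟩ := (G.degree_pos_iff_exists_adj u).1 (by omega)
        have h1 := h7.2 u v huv hu
        have h2 := hdeg v
        rw [h7.1]
        exact secondValue_seven_lt hG (by omega) (show G.degree v = 5 by omega) h7.2
      obtain ⟨u, v, huv, hu, hv⟩ : ∃ u v, G.Adj u v ∧ G.degree u = 1 ∧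
          (n + 1 = 7 → G.degree v ≤ 4) := by
        by_cases hn7 : n + 1 = 7
        · simp only [hn7, true_and] at h7
          push Not at h7
          obtain ⟨u, v, huv, hu, hv⟩ := h7
          exact ⟨u, v, huv, hu, fun _ => by omega⟩
        · obtain ⟨u, hu⟩ := hp
          obtain ⟨v, huv⟩ := (G.degree_pos_iff_exists_adj u).1 (by omega)
          exact ⟨u, v, huv, hu, fun h => (hn7 h).elim⟩
      obtain ⟨W, _, H, w, e, hH, rfl⟩ := exists_iso_attachPendents_of_degree_eq_one hG huv hu
      have hW := Fintype.card_congr e.toEquiv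
      rw [Fintype.card_sum, Fintype.card_unit, hV] at hW
      have hW : Fintype.card W = n := by omega
      have hdw := degree_of_iso_attachPendents e
      rw [hdw] at hv
      have h1 := hdeg (e (Sum.inl w))
      rw [hdw] at h1
      have hpos := degree_pos_of_mem_bicyclicGraphs hH w
      obtain ⟨x, hwx, hx⟩ := exists_adj_two_le_degree hH w
      have hgain := add_pendentGain_le H hwx hx
      rw [sumConnectivity_congr e] at hgain
      by_cases hc : ∃ c, H.degree c + 1 = Fintype.card W
      · obtain ⟨c, hc⟩ := hc
        rcases lt_or_ge (H.degree w) 3 with h3 | h3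
        · right
          have h4 := le_sumConnectivity_of_degree_add_one_eq_card hH hc
          have h5 := secondValue_lt_add_pendentGain_three (n := n + 1) (by omega)
          have h6 := pendentGain_anti (d := H.degree w + 1) (e := 3) (by omega) (by omega)
          rw [hW, show n - 1 = n + 1 - 2 by omega] at h4
          linarith
        -- If `w` were `c`, its degree in `G` would be n, against the bound n - 1.
        · have hwc : w ≠ c := by
            rintro rfl
            omega
          obtain ⟨e'⟩ := iso_graphB_of_three_le_degree hH hc hwc h3
          rw [hW, show n - 1 = n + 1 - 2 by omega] at e'
          rcases lt_or_ge (n + 1) 8 with h8 | h8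
          · exact Or.inl (Or.inr ⟨by omega, ⟨e.symm.trans e'⟩⟩)
          · right
            rw [sumConnectivity_congr (e.symm.trans e')]
            exact secondValue_lt_graphB_four h8
      · right
        push Not at hc
        have h2 : ∀ y, H.degree y + 2 ≤ n := by
          intro y
          have h3 := degree_le_of_iso_attachPendents e y
          have h4 := hdeg (e (Sum.inl y))
          have h5 := hc y
          omega
        have h3 : secondValue n ≤ sumConnectivity H := by
          rcases ih hW hH h2 with h | h
          · exact h.sumConnectivity_eq.ge
          · exact h.le
        have h4 := secondValue_lt_add_pendentGain (n := n + 1) (d := H.degree w + 1) (by omega)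
          (by omega) h1 hv
        rw [Nat.add_sub_cancel] at h4
        linarith
    · right
      push Not at hp
      have h2 : ∀ v, 2 ≤ G.degree v := by
        intro v
        have := hp v
        have := degree_pos_of_mem_bicyclicGraphs hG v
        omega
      -- With all degrees at least 2, the degree sum leaves an excess of 2 in total, so no degree
      -- exceeds 4. The bound is then half the number of vertices.
      have h1 := le_sumConnectivity_of_two_le_degree hG (k := 2) h2 (fun v => by
        have h3 := sum_degree_of_mem_bicyclicGraphs hG
        rw [← Finset.add_sum_erase _ _ (Finset.mem_univ v)] at h3
        have h4 := Finset.card_nsmul_le_sum (Finset.univ.erase v) (fun v => G.degree v) 2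
          fun x _ => h2 x
        rw [Finset.card_erase_of_mem (Finset.mem_univ v), Finset.card_univ, smul_eq_mul] at h4
        omega)
      have h3 := secondValue_lt_half (n := n + 1) (by omega)
      rw [hV] at h1
      norm_num at h1 h3
      linarith

/-! ### From the trichotomy to the two minima -/

/-- Copies of a bicyclic graph exist on every vertex set of the right size. -/
theorem exists_iso_of_card_eq {V W : Type*} [Fintype V] [Fintype W] {B : SimpleGraph W}
    (hB : B ∈ bicyclicGraphs W) (h : Fintype.card V = Fintype.card W) :
    ∃ G ∈ bicyclicGraphs V, Nonempty (G ≃g B) := by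
  let e := Iso.map (Fintype.equivOfCardEq h.symm) B
  exact ⟨_, mem_bicyclicGraphs_congr e hB, ⟨e.symm⟩⟩

/-- Order bookkeeping: both minima and both uniqueness claims follow once every graph is a copy of
`B₁`, a copy of `B₂`, or strictly above `B₂`. -/
theorem isUniqueMinimum_and_isUniqueSecondMinimum {V W₁ W₂ : Type*} [Fintype V] [Fintype W₁]
    [Fintype W₂] {B₁ : SimpleGraph W₁} {B₂ : SimpleGraph W₂} (h₁ : B₁ ∈ bicyclicGraphs W₁)
    (h₂ : B₂ ∈ bicyclicGraphs W₂) (hW₁ : Fintype.card V = Fintype.card W₁)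
    (hW₂ : Fintype.card V = Fintype.card W₂) (hlt : sumConnectivity B₁ < sumConnectivity B₂)
    (h : ∀ G ∈ bicyclicGraphs V, Nonempty (G ≃g B₁) ∨ Nonempty (G ≃g B₂) ∨
      sumConnectivity B₂ < sumConnectivity G) :
    IsUniqueMinimum V B₁ (sumConnectivity B₁) ∧
      IsUniqueSecondMinimum V B₂ (sumConnectivity B₂) := by
  obtain ⟨G₁, hG₁, ⟨e₁⟩⟩ := exists_iso_of_card_eq h₁ hW₁
  obtain ⟨G₂, hG₂, ⟨e₂⟩⟩ := exists_iso_of_card_eq h₂ hW₂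
  have hv₁ := sumConnectivity_congr e₁
  have hv₂ := sumConnectivity_congr e₂
  refine ⟨⟨⟨⟨G₁, hG₁, hv₁⟩, ?_⟩, ?_⟩, ⟨⟨⟨⟨G₂, hG₂, hv₂⟩, _, ⟨G₁, hG₁, hv₁⟩, hlt⟩, ?_⟩, ?_⟩⟩
  · rintro _ ⟨G, hG, rfl⟩
    rcases h G hG with ⟨⟨e⟩⟩ | ⟨⟨e⟩⟩ | hG'
    · exact (sumConnectivity_congr e).ge
    · rw [sumConnectivity_congr e]
      exact hlt.le
    · exact (hlt.trans hG').le
  · intro G hG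
    refine ⟨fun hc => ?_, fun ⟨e⟩ => sumConnectivity_congr e⟩
    rcases h G hG with he | ⟨⟨e⟩⟩ | hG'
    · exact he
    · rw [sumConnectivity_congr e] at hc
      exact (hlt.ne' hc).elim
    · exact ((hlt.trans hG').ne' hc).elim
  · rintro _ ⟨⟨G, hG, rfl⟩, _, ⟨G', hG', rfl⟩, hlt'⟩
    rcases h G hG with ⟨⟨e⟩⟩ | ⟨⟨e⟩⟩ | hG''
    · rw [sumConnectivity_congr e] at hlt'
      exfalso
      rcases h G' hG' with ⟨⟨e'⟩⟩ | ⟨⟨e'⟩⟩ | hG''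
      · exact hlt'.ne (sumConnectivity_congr e')
      · rw [sumConnectivity_congr e'] at hlt'
        exact hlt.asymm hlt'
      · exact (hlt.trans hG'').asymm hlt'
    · exact (sumConnectivity_congr e).ge
    · exact hG''.le
  · intro G hG
    refine ⟨fun hc => ?_, fun ⟨e⟩ => sumConnectivity_congr e⟩
    rcases h G hG with ⟨⟨e⟩⟩ | he | hG'
    · rw [sumConnectivity_congr e] at hc
      exact (hlt.ne hc).elim
    · exact he
    · exact (hG'.ne' hc).elim

theorem iso_or_isSecondMinimizer_or_secondValue_lt {V : Type*} [Fintype V] {n : ℕ} (hn : 5 ≤ n)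
    (hV : Fintype.card V = n) {G : SimpleGraph V} (hG : G ∈ bicyclicGraphs V) :
    Nonempty (G ≃g graphB (n - 1) 3) ∨ Nonempty (G ≃g graphBThree n) ∨
      IsSecondMinimizer n G ∨ secondValue n < sumConnectivity G := by
  subst hV
  by_cases hc : ∃ c, G.degree c + 1 = Fintype.card V
  · obtain ⟨c, hc⟩ := hc
    rcases iso_graphB_or_graphBThree hG hc with h | h
    · exact Or.inl h
    · exact Or.inr (Or.inl h.2)
  · push Not at hc
    refine Or.inr (Or.inr (isSecondMinimizer_or_secondValue_lt hn rfl hG fun v => ?_))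
    have := hc v
    have := G.degree_lt_card_verts v
    omega

theorem isUniqueMinimum_and_isUniqueSecondMinimum_of_le_seven {V W : Type*} [Fintype V]
    [Fintype W] {n : ℕ} (hn : 5 ≤ n) (h7 : n ≤ 7) (hV : Fintype.card V = n) {B : SimpleGraph W}
    (hB : B ∈ bicyclicGraphs W) (hW : Fintype.card W = n) (hBv : sumConnectivity B = secondValue n)
    (hiso : ∀ {G : SimpleGraph V}, IsSecondMinimizer n G → Nonempty (G ≃g B)) :
    IsUniqueMinimum V (graphB (n - 1) 3) (sumConnectivity (graphB (n - 1) 3)) ∧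
      IsUniqueSecondMinimum V B (sumConnectivity B) := by
  refine isUniqueMinimum_and_isUniqueSecondMinimum (graphB_mem_bicyclicGraphs _ _) hB
    (by simp; omega) (by omega) (by rw [hBv]; exact graphB_three_lt_secondValue hn) ?_
  intro G hG
  rcases iso_or_isSecondMinimizer_or_secondValue_lt hn hV hG with h | ⟨⟨e⟩⟩ | h | h
  · exact Or.inl h
  · right; right
    rw [sumConnectivity_congr e, hBv]
    exact secondValue_lt_graphBThree hn h7
  · exact Or.inr (Or.inl (hiso h))
  · exact Or.inr (Or.inr (hBv ▸ h))

theorem isUniqueMinimum_and_isUniqueSecondMinimum_of_eight_le {V : Type*} [Fintype V]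
    {n : ℕ} (hn : 8 ≤ n) (hV : Fintype.card V = n) :
    IsUniqueMinimum V (graphB (n - 1) 3) (sumConnectivity (graphB (n - 1) 3)) ∧
      IsUniqueSecondMinimum V (graphBThree n) (sumConnectivity (graphBThree n)) := by
  refine isUniqueMinimum_and_isUniqueSecondMinimum (graphB_mem_bicyclicGraphs _ _)
    (graphBThree_mem_bicyclicGraphs _) (by simp; omega) (by simp; omega)
    (sumConnectivity_graphB_three_lt_graphBThree (by omega)) ?_
  intro G hG
  rcases iso_or_isSecondMinimizer_or_secondValue_lt (by omega) hV hG with h | h | h | h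
  · exact Or.inl h
  · exact Or.inr (Or.inl h)
  · rcases h with ⟨h, -⟩ | ⟨h, -⟩ <;> omega
  · rw [secondValue_of_eight_le hn] at h
    exact Or.inr (Or.inr h)

end SumConn

end

theorem mainTheorem4 {V : Type*} [Fintype V] (n : ℕ) (hn : 5 ≤ n) (hV : Fintype.card V = n) :
    SumConn.IsUniqueMinimum V (SumConn.graphB (n - 1) 3)
      (1 / √((n : ℝ) + 2) + ((n : ℝ) - 4) / √(n : ℝ) + 2 / √((n : ℝ) + 1) + 2 / √5) ∧
    (n = 5 →
      SumConn.IsUniqueSecondMinimum V SumConn.graphFive (3 / √6 + 2 / √5 + 1 / 2)) ∧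
    (n = 6 ∨ n = 7 →
      SumConn.IsUniqueSecondMinimum V (SumConn.graphB (n - 2) 4)
        (1 / √((n : ℝ) + 2) + 2 / √(n : ℝ) + ((n : ℝ) - 5) / √((n : ℝ) - 1)
          + 2 / √6 + 1 / √5)) ∧
    (8 ≤ n →
      SumConn.IsUniqueSecondMinimum V (SumConn.graphBThree n)
        (4 / √((n : ℝ) + 1) + ((n : ℝ) - 5) / √(n : ℝ) + 1)) := by
  have hmin : 1 / √((n : ℝ) + 2) + ((n : ℝ) - 4) / √(n : ℝ) + 2 / √((n : ℝ) + 1) + 2 / √5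
      = SumConn.sumConnectivity (SumConn.graphB (n - 1) 3) := by
    rw [SumConn.sumConnectivity_graphB_three (by omega)]
    simp [SumConn.invSqrt, div_eq_mul_inv]
  have hfive : 3 / √6 + 2 / √5 + 1 / 2 = SumConn.sumConnectivity SumConn.graphFive := by
    rw [SumConn.sumConnectivity_graphFive]
    simp [SumConn.invSqrt, div_eq_mul_inv]
  have hfour : 1 / √((n : ℝ) + 2) + 2 / √(n : ℝ) + ((n : ℝ) - 5) / √((n : ℝ) - 1)
      + 2 / √6 + 1 / √5 = SumConn.sumConnectivity (SumConn.graphB (n - 2) 4) := by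
    rw [SumConn.sumConnectivity_graphB_four hn]
    simp [SumConn.invSqrt, div_eq_mul_inv, Nat.cast_sub (show 1 ≤ n by omega)]
  have hthree : 4 / √((n : ℝ) + 1) + ((n : ℝ) - 5) / √(n : ℝ) + 1
      = SumConn.sumConnectivity (SumConn.graphBThree n) := by
    rw [SumConn.sumConnectivity_graphBThree hn]
    simp [SumConn.invSqrt, div_eq_mul_inv]
  rw [hmin, hfive, hfour, hthree]
  rcases lt_or_ge n 8 with h8 | h8
  · rcases hn.eq_or_lt with rfl | h6
    · obtain ⟨h1, h2⟩ := SumConn.isUniqueMinimum_and_isUniqueSecondMinimum_of_le_seven le_rfl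
        (by norm_num) hV SumConn.graphFive_mem_bicyclicGraphs (by simp)
        SumConn.secondValue_five.symm (fun h => by
          rcases h with ⟨-, h⟩ | ⟨h, -⟩
          · exact h
          · omega)
      exact ⟨h1, fun _ => h2, fun h => by omega, fun h => by omega⟩
    · obtain ⟨h1, h2⟩ := SumConn.isUniqueMinimum_and_isUniqueSecondMinimum_of_le_seven hn
        (by omega) hV (SumConn.graphB_mem_bicyclicGraphs (n - 2) 4) (by simp; omega)
        (SumConn.secondValue_of_le_seven h6 (by omega)).symm (fun h => by
          rcases h with ⟨h, -⟩ | ⟨-, h⟩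
          · omega
          · exact h)
      exact ⟨h1, fun h => by omega, fun _ => h2, fun h => by omega⟩
  · obtain ⟨h1, h2⟩ := SumConn.isUniqueMinimum_and_isUniqueSecondMinimum_of_eight_le h8 hV
    exact ⟨h1, fun h => by omega, fun h => by omega, fun _ => h2⟩
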